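/- Let $q$ be a prime power, $n\ge 1$, and write $[k]_s=1+s+\dots+s^{k-1}=\frac{s^k-1}{s-1}$. For an $\mathbb F_q$-subspace $U$ of an $\mathbb F_{q^n}$-vector space $V$, let $L_U=\{\langle u\rangle_{\mathbb F_{q^n}} : u\in U\setminus\{0\}\}\subseteq \mathrm{PG}(V,\mathbb F_{q^n})$ be the associated $\mathbb F_q$-linear set; its rank is $\dim_{\mathbb F_q}U$. For an integer $h$ with $1\le h\le d-1$, a linear set $L_{U_1}$ in $\mathrm{PG}(d-1,q^n)$ is $h$-scattered if it spans $\mathrm{PG}(d-1,q^n)$ and $\dim_{\mathbb F_q}(U_1\cap W)\le h$ for every $\mathbb F_{q^n}$-subspace $W$ of dimension $h$; it is properly maximum $h$-scattered if moreover its rank is $\frac{dn}{h+1}$. A set of points is said to be of type $(m_1,m_2,\dots)$ with respect to hyperplanes if the set of its intersection sizes with hyperplanes is exactly $\{m_1,m_2,\dots\}$. Let $\pi_\infty=\mathrm{PG}(r-1,q^n)$ be a hyperplane of $\mathrm{PG}(r,q^n)$, let $S_1$ be a $(d-1)$-dimensional subspace of $\pi_\infty$ and $S_2=\mathrm{PG}(W,\mathbb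 F_{q^n})$ a complementary $(r-d-1)$-dimensional subspace of $\pi_\infty$ ($d\le r$; $S_2$ is empty if $d=r$). Let $L_{U_1}$ be a properly maximum $h$-scattered $\mathbb F_q$-linear set in $S_1$ and let $U=U_1\oplus W$. Then $L_U$ is the cone $\bigcup_{P\in L_{U_1}}\langle P,S_2\rangle$ with vertex $S_2$ and basis $L_{U_1}$. Let $Q=\langle y\rangle_{\mathbb F_{q^n}}$ be a point of $\mathrm{PG}(r,q^n)\setminus\pi_\infty$, let $U'=U\oplus\langle y\rangle_{\mathbb F_q}$ and let $$\mathcal K=(L_{U'}\setminus L_U)\cup(\pi_\infty\setminus L_U).$$ For $i\in\{0,\dots,h\}$ and $j\in\{0,1\}$ put $\gamma_i=\frac{dn}{h+1}-n+i$, and let $\beta_{i,j}=0$ if $j=0$ and $i\ge1$, and $\beta_{i,j}=q^{\gamma_i}$ otherwise. Then $$|\mathcal K|=q^{n(r-d)}\left([d]_{q^n}-\left[\tfrac{dn}{h+1}\right]_q+q^{\frac{dn}{h+1}}\right),$$ and $\mathcal K$ is, with respect to the hyperplanes of $\mathrm{PG}(r,q^n)$, of type consisting exactly of the numbers 1. $q^{n(r-d)}\left([d]_{q^n}-\left[\frac{dn}{h+1}\right]_q\right)$;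 2. $q^{n(r-d-1)}\left([d]_{q^n}-\left[\frac{dn}{h+1}\right]_q+q^{\frac{dn}{h+1}}\right)$, which is present only if $d<r$; 3. $q^{n(r-d)}\left([d-1]_{q^n}-[\gamma_i]_q+\beta_{i,j}\right)$ for $i\in\{0,\dots,h\}$, $j\in\{0,1\}$. In particular, if $q=2$, then $|\mathcal K|=2^{n(r-d)}\left([d]_{2^n}+1\right)$, and $\mathcal K$ is of type consisting exactly of $2^{n(r-d)}\left([d]_{2^n}-2^{\frac{dn}{h+1}}+1\right)$, of $2^{n(r-d-1)}\left([d]_{2^n}+1\right)$ if $d<r$, and of $2^{n(r-d)}\left([d-1]_{2^n}-2^{\gamma_i}+1+\beta_{i,j}\right)$ for $i\in\{0,\dots,h\}$, $j\in\{0,1\}$. For $q=2$ this gives in total $2h+3$ possibilities for a hyperplane $\pi$ if $d<r$, and $2h+2$ if $d=r$, in the sense that this is the number of distinct pairs $(|\mathcal K\cap\pi\cap\pi_\infty|,\ |(\mathcal K\cap\pi)\setminus\pi_\infty|)$. Some of these possibilities have the same total: for $q=2$ the number of distinct intersection numbers $|\mathcal K\cap\pi|$ is $h+3$ if $d<r$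 and $h+2$ if $d=r$, diminished by one if $d=2$. -/

import Mathlib

open Module
open scoped LinearAlgebra.Projectivization

/-- `[k]_q = 1 + q + ⋯ + q ^ (k - 1)`, which is `(q ^ k - 1) / (q - 1)` for `q ≠ 1`, as an integer. -/
def qBracket (q k : ℕ) : ℤ := ∑ i ∈ Finset.range k, (q : ℤ) ^ i

section Geometry

variable {F K V : Type*} [Field F] [Field K] [Algebra F K]
  [AddCommGroup V] [Module K V] [Module F V] [IsScalarTower F K V]

/-- The points of the projective subspace `PG(W, K)` of `PG(V, K)`. -/
def subspacePoints (W : Submodule K V) : Set (ℙ K V) := {p | p.submodule ≤ W}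

/-- The `F`-linear set `L_U = {⟨u⟩_K : u ∈ U, u ≠ 0}` in `PG(V, K)`. -/
def linearSet (K : Type*) {F V : Type*} [Field F] [Field K] [AddCommGroup V] [Module K V]
    [Module F V] (U : Submodule F V) : Set (ℙ K V) :=
  {p | ∃ u ∈ U, ∃ hu : u ≠ 0, p = Projectivization.mk K u hu}

/-- The cone with vertex `PG(S₂, K)` and basis the point set `B`: the union of the subspaces
`⟨P, PG(S₂, K)⟩` for `P ∈ B`. -/
def projectiveCone (S₂ : Submodule K V) (B : Set (ℙ K V)) : Set (ℙ K V) :=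
  ⋃ P ∈ B, subspacePoints (P.submodule ⊔ S₂)

/-- `L_U` is an `h`-scattered `F`-linear set of `PG(S, K)`, where `1 ≤ h ≤ dim S - 1`: it spans
`PG(S, K)` and every `(h - 1)`-dimensional projective subspace `PG(W, K)` of `PG(S, K)` has weight
`dim_F (U ∩ W)` at most `h`. (The span condition contains `U ⊆ S`.) -/
def IsHScattered (h : ℕ) (S : Submodule K V) (U : Submodule F V) : Prop :=
  1 ≤ h ∧ h + 1 ≤ finrank K S ∧
  Submodule.span K (U : Set V) = S ∧
  ∀ W : Submodule K V, W ≤ S → finrank K W = h →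
    finrank F (U ⊓ W.restrictScalars F : Submodule F V) ≤ h

/-- `L_U` is a properly maximum `h`-scattered `F`-linear set of `PG(S, K)`: it is `h`-scattered
and its rank is `(dim S) [K : F] / (h + 1)`. -/
def IsProperlyMaximumHScattered (h : ℕ) (S : Submodule K V) (U : Submodule F V) : Prop :=
  IsHScattered h S U ∧ (h + 1) * finrank F U = finrank K S * finrank F K

/-- The set `K = (L_{U'} \ L_U) ∪ (π_∞ \ L_U)`, where `π_∞ = PG(E, K)` and `U' = U ⊕ ⟨y⟩_F`. -/
def switchedSet (E : Submodule K V) (U : Submodule F V) (y : V) : Set (ℙ K V) :=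
  (linearSet K (U ⊔ Submodule.span F {y}) \ linearSet K U) ∪ (subspacePoints E \ linearSet K U)

/-- `H` is a hyperplane of `V`, so that `PG(H, K)` is a hyperplane of `PG(V, K)`. -/
def IsHyperplane (H : Submodule K V) : Prop := finrank K H + 1 = finrank K V

/-- The intersection numbers of a point set `X` with respect to the hyperplanes: all the numbers
`|X ∩ H|` and no others. So `X` is of type `(m₁, …, m_s)` with respect to hyperplanes if and only
if this set is `{m₁, …, m_s}`. -/
def intersectionNumbers (X : Set (ℙ K V)) : Set ℕ :=
  {m | ∃ H : Submodule K V, IsHyperplane H ∧ m = (X ∩ subspacePoints H).ncard}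

/-- For the hyperplanes `H`, all the pairs consisting of the number of points of `X ∩ H` in
`PG(E, K)` ("at infinity") and the number of points of `X ∩ H` outside it ("affine"). -/
def intersectionPairs (E : Submodule K V) (X : Set (ℙ K V)) : Set (ℕ × ℕ) :=
  {m | ∃ H : Submodule K V, IsHyperplane H ∧
    m = ((X ∩ subspacePoints H ∩ subspacePoints E).ncard,
      ((X ∩ subspacePoints H) \ subspacePoints E).ncard)}

end Geometry

/-- `γ_i = dn/(h+1) - n + i`. In the situation of the theorem `h + 1` divides `dn` and
`n ≤ dn/(h+1)`, so the natural number operations are exact. -/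
def gammaRank (d n h i : ℕ) : ℕ := d * n / (h + 1) - n + i

/-- `β_{i,j} = 0` if `j = 0` and `i ≥ 1`, and `β_{i,j} = q ^ γ_i` otherwise. -/
def betaTerm (q d n h i j : ℕ) : ℤ :=
  if j = 0 ∧ 1 ≤ i then 0 else (q : ℤ) ^ gammaRank d n h i

/-! Write k = dn/(h+1) for the rank of `U₁`. A hyperplane is the kernel of a functional φ, and its
intersection with the switched set depends only on how φ acts on `S₂`, `S₁` and `y`. The affine
points of the set are the ⟨u + y⟩ with u in `U`, each obtained once, so ker φ contains as many of
them as there are u in `U` with φ(u) = -φ(y): none, or a coset of U ∩ ker φ. The vectors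
representing the points at infinity form a sum B + S₂, where B represents the points of `S₁` outside
`L_{U₁}`. If φ does not vanish on `S₂`, its fibres on such a sum all have the same size, and both
counts are the global ones divided by q^n. If φ vanishes on `S₂`, the vertex contributes only a
factor |S₂|, and what remains is governed by the weight dim (U₁ ∩ ker φ), because every point of
`L_{U₁}` has weight one.

The core is that, for φ nonzero on `S₁`, these weights are exactly γ_0, ..., γ_h. The maps u ↦ a(u)
from `U₁` to K, with a in the dual of `S₁`, form a rank-metric code of F-dimension dn = (h+1)k, and
this code is MRD. By scatteredness, h+1 vectors of `U₁` independent over F are independent over K,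
whence `componentMap_surjective`: for s ≤ h+1, the components of a with respect to s independent
functionals on K can be prescribed freely. So the a whose image is killed by s given functionals
form a space of dimension (h+1-s)k. For s = h+1 this gives rank at least n-h
(`finrank_le_finrank_range_pullDual`); comparing s = i with s = i+1 gives an element of each rank
n-i (`exists_finrank_range_pullDual_eq`). Since φ(y) is free, the coset can be made empty exactly
when the image is not all of K, that is, when i ≥ 1.

For q = 2, [γ]_2 = 2^γ - 1, so a nonempty coset of size 2^γ cancels the weight from the total. Hence
the 2h+1 pairs of the third kind have only h+1 totals; size and divisibility by 4 separate the
others, except for one coincidence when d = 2. -/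

/-! ### The rank-metric code of a scattered subspace: minimum rank and occurring ranks. -/

section RankCode

variable {F K S A : Type*} [Field F] [Field K] [Algebra F K]
  [AddCommGroup S] [Module K S] [Module F S] [IsScalarTower F K S]
  [AddCommGroup A] [Module F A]

/-- The `F`-linear map `u ↦ a (f u)` attached to a `K`-linear functional `a`. -/
def pullDual (f : A →ₗ[F] S) : Dual K S →ₗ[F] (A →ₗ[F] K) where
  toFun a := a.restrictScalars F ∘ₗ f
  map_add' _ _ := rfl
  map_smul' _ _ := rfl

@[simp] theorem pullDual_apply (f : A →ₗ[F] S) (a : Dual K S) (u : A) :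
    pullDual f a u = a (f u) := rfl

/-- The `F`-components of `u ↦ a (f u)` with respect to a family of functionals on `K`. -/
def componentMap {s : ℕ} (f : A →ₗ[F] S) (l : Fin s → Dual F K) :
    Dual K S →ₗ[F] (Fin s → Dual F A) :=
  LinearMap.pi fun j => (LinearMap.compRight F (l j)) ∘ₗ pullDual f

@[simp] theorem componentMap_apply {s : ℕ} (f : A →ₗ[F] S) (l : Fin s → Dual F K)
    (a : Dual K S) (j : Fin s) (u : A) : componentMap f l a j u = l j (a (f u)) := rfl

theorem LinearIndependent.submoduleCoe {ι : Type*} {p : Submodule F A} {v : ι → p}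
    (hv : LinearIndependent F v) : LinearIndependent F (fun i => (v i : A)) :=
  hv.map' p.subtype p.ker_subtype

theorem exists_le_finrank_eq [FiniteDimensional F A] (N : Submodule F A) (m : ℕ)
    (hN : finrank F N ≤ m) (hm : m ≤ finrank F A) :
    ∃ T : Submodule F A, N ≤ T ∧ finrank F T = m := by
  induction m, hN using Nat.le_induction with
  | base => exact ⟨N, le_rfl, rfl⟩
  | succ m _ ih =>
    obtain ⟨T, hT, rfl⟩ := ih (by omega)
    have : T ≠ ⊤ := by
      rintro rfl
      simp at hm
    obtain ⟨x, -, hx⟩ := SetLike.exists_of_lt this.lt_top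
    exact ⟨T ⊔ Submodule.span F {x}, hT.trans le_sup_left, Submodule.finrank_sup_span_singleton hx⟩

/-- Every `t` vectors of `A` that are independent over `F` have images independent over `K`. -/
def IndependencePreserving (K : Type*) {F S A : Type*} [Field F] [Field K] [AddCommGroup S]
    [Module K S] [Module F S] [AddCommGroup A] [Module F A] (f : A →ₗ[F] S) (t : ℕ) : Prop :=
  ∀ e : Fin t → A, LinearIndependent F e → LinearIndependent K (fun i => f (e i))

theorem exists_dual_apply_eq {t : ℕ} {e : Fin t → S} (he : LinearIndependent K e)
    (c : Fin t → K) : ∃ a : Dual K S, ∀ i, a (e i) = c i := by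
  obtain ⟨g, hg⟩ := LinearMap.exists_extend (p := Submodule.span K (Set.range e))
    ((Basis.span he).constr K c)
  refine ⟨g, fun i => ?_⟩
  have h1 := LinearMap.congr_fun hg (Basis.span he i)
  rw [Basis.constr_basis] at h1
  simpa [Basis.span_apply] using h1

variable [FiniteDimensional F A]

/-- Dually, no nonzero ψ may vanish on the image. Such a ψ is given by s ≤ t vectors of `A`; these
lie in a t-dimensional subspace, on a basis of which the values of a are arbitrary, so independence
of `l` forces the vectors to be 0. -/
theorem componentMap_surjective {s t : ℕ} {f : A →ₗ[F] S} (hf : IndependencePreserving K f t)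
    (ht : t ≤ finrank F A) (hs : s ≤ t) {l : Fin s → Dual F K} (hl : LinearIndependent F l) :
    Function.Surjective (componentMap f l) := by
  classical
  rw [← LinearMap.dualMap_injective_iff, injective_iff_map_eq_zero]
  intro ψ hψ
  have key : ∃ u : Fin s → A, ∀ g, ψ g = ∑ j, g j (u j) := by
    -- By reflexivity of `A`, each component of ψ is evaluation at a vector.
    refine ⟨fun j => (evalEquiv F A).symm (ψ ∘ₗ LinearMap.single F (fun _ => Dual F A) j), ?_⟩
    intro g
    simp only [apply_evalEquiv_symm_apply]
    conv_lhs => rw [← Finset.univ_sum_single g]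
    simp
  obtain ⟨u, hu⟩ := key
  have hspan : finrank F (Submodule.span F (Set.range u)) ≤ t :=
    (finrank_range_le_card u).trans (by simpa using hs)
  obtain ⟨T, hT, hTt⟩ := exists_le_finrank_eq _ t hspan ht
  let b : Basis (Fin t) F T := (finBasisOfFinrankEq F T hTt)
  have hb : LinearIndependent F (fun i => (b i : A)) :=
    b.linearIndependent.submoduleCoe
  have hbK := hf _ hb
  have huT : ∀ j, u j ∈ T := fun j => hT (Submodule.subset_span ⟨j, rfl⟩)
  have hexp : ∀ j, u j = ∑ i, b.repr ⟨u j, huT j⟩ i • (b i : A) := fun j => by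
    have := congrArg Subtype.val (b.sum_repr ⟨u j, huT j⟩)
    simp only [Submodule.coe_sum, Submodule.coe_smul] at this
    exact this.symm
  have hzero : ∀ i, ∑ j, b.repr ⟨u j, huT j⟩ i • l j = 0 := by
    intro i
    ext c
    -- Testing on the functional with value c at the i-th basis vector and 0 at the others isolates
    -- the i-th coordinates of the `u j`.
    obtain ⟨a, ha⟩ := exists_dual_apply_eq hbK (Pi.single i c)
    have h0 : ψ (componentMap f l a) = 0 := LinearMap.congr_fun hψ a
    rw [hu] at h0
    simp only [componentMap_apply] at h0
    simp only [LinearMap.sum_apply, LinearMap.smul_apply, LinearMap.zero_apply]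
    rw [← h0]
    refine Finset.sum_congr rfl fun j _ => ?_
    conv_rhs => rw [hexp j]
    have hval : ∀ i', a (f (b.repr ⟨u j, huT j⟩ i' • (b i' : A))) =
        b.repr ⟨u j, huT j⟩ i' • (Pi.single i c : Fin t → K) i' := by
      intro i'
      rw [map_smul, ← ha i', ← LinearMap.restrictScalars_apply F a, map_smul]
      rfl
    rw [map_sum, map_sum, Finset.sum_congr rfl fun i' _ => hval i',
      Finset.sum_eq_single i (fun i' _ hi' => by simp [hi']) (by simp)]
    simp
  have hcoef : ∀ j i, b.repr ⟨u j, huT j⟩ i = 0 := fun j i =>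
    Fintype.linearIndependent_iff.1 hl _ (hzero i) j
  refine LinearMap.ext fun g => ?_
  rw [hu, LinearMap.zero_apply]
  refine Finset.sum_eq_zero fun j _ => ?_
  rw [hexp j]
  simp [hcoef]

variable [FiniteDimensional F K] [FiniteDimensional K S]

theorem finrank_ker_componentMap {s t : ℕ} {f : A →ₗ[F] S}
    (hf : IndependencePreserving K f t) (ht : t ≤ finrank F A) (hs : s ≤ t)
    (hdim : t * finrank F A = finrank K S * finrank F K)
    {l : Fin s → Dual F K} (hl : LinearIndependent F l) :
    finrank F (LinearMap.ker (componentMap f l)) + s * finrank F A = t * finrank F A := by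
  have : FiniteDimensional F (Dual K S) := FiniteDimensional.trans F K (Dual K S)
  have h1 := (componentMap f l).finrank_range_add_finrank_ker
  rw [LinearMap.range_eq_top.2 (componentMap_surjective hf ht hs hl), finrank_top,
    ← finrank_mul_finrank F K (Dual K S), Subspace.dual_finrank_eq, Module.finrank_pi_fintype] at h1
  simp only [Subspace.dual_finrank_eq, Finset.sum_const, Finset.card_univ, Fintype.card_fin,
    smul_eq_mul] at h1
  rw [hdim, mul_comm (finrank K S), ← h1, add_comm]

omit [FiniteDimensional F A] in
theorem finrank_range_add_annihilator (g : A →ₗ[F] K) :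
    finrank F (LinearMap.range g) + finrank F (LinearMap.range g).dualAnnihilator = finrank F K :=
  Subspace.finrank_add_finrank_dualAnnihilator_eq _

theorem finrank_le_finrank_range_pullDual {h : ℕ} {f : A →ₗ[F] S}
    (hf : IndependencePreserving K f (h + 1)) (ht : h + 1 ≤ finrank F A)
    (hdim : (h + 1) * finrank F A = finrank K S * finrank F K)
    {a : Dual K S} (ha : a ≠ 0) :
    finrank F K ≤ finrank F (LinearMap.range (pullDual f a)) + h := by
  have : FiniteDimensional F (Dual K S) := FiniteDimensional.trans F K (Dual K S)
  by_contra hlt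
  have h1 := finrank_range_add_annihilator (pullDual f a)
  have hcodim : h + 1 ≤ finrank F (LinearMap.range (pullDual f a)).dualAnnihilator := by
    omega
  obtain ⟨l, hl⟩ := exists_linearIndependent_of_le_finrank (R := F) hcodim
  have hl' : LinearIndependent F (fun i => (l i : Dual F K)) :=
    hl.submoduleCoe
  -- With s = h+1 the kernel has dimension 0, but it contains the nonzero a.
  have h2 := Nat.add_eq_right.1 (finrank_ker_componentMap hf ht le_rfl hdim hl')
  rw [Submodule.finrank_eq_zero, Submodule.eq_bot_iff] at h2
  refine ha (h2 a (LinearMap.mem_ker.2 (funext fun j => LinearMap.ext fun u => ?_)))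
  rw [componentMap_apply]
  exact (Submodule.mem_dualAnnihilator _).1 (l j).2 _ ⟨u, rfl⟩

/-- Fix i independent functionals `l`. If every a killed by `l` were killed by a further m outside
their span, the q^((h+1-i)k) such a would be covered by fewer than q^n sets of size q^((h-i)k),
which is impossible as n ≤ k. So for some a the annihilator of the image is exactly the span of `l`.
-/
theorem exists_finrank_range_pullDual_eq [Finite F] {h i : ℕ} {f : A →ₗ[F] S}
    (hf : IndependencePreserving K f (h + 1)) (ht : h + 1 ≤ finrank F A)
    (hdim : (h + 1) * finrank F A = finrank K S * finrank F K)
    (hi : i ≤ h) (hn : h + 1 ≤ finrank F K) (hnk : finrank F K ≤ finrank F A) :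
    ∃ a : Dual K S, finrank F (LinearMap.range (pullDual f a)) + i = finrank F K := by
  classical
  have : FiniteDimensional F (Dual K S) := FiniteDimensional.trans F K (Dual K S)
  have : Finite (Dual K S) := Module.finite_of_finite F
  have : Finite (Dual F K) := Module.finite_of_finite F
  cases nonempty_fintype (Dual F K)
  cases nonempty_fintype (Dual K S)
  obtain ⟨l, hl⟩ := exists_linearIndependent_of_le_finrank (R := F) (M := Dual F K) (n := i)
    (by rw [Subspace.dual_finrank_eq]; omega)
  have hq : 1 < Nat.card F := Finite.one_lt_card
  have hcard : ∀ {s : ℕ} (m : Fin s → Dual F K), LinearIndependent F m → s ≤ h + 1 →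
      (Finset.univ.filter fun a => a ∈ LinearMap.ker (componentMap f m)).card =
        Nat.card F ^ ((h + 1 - s) * finrank F A) := by
    intro s m hm hs
    have h1 := finrank_ker_componentMap hf ht hs hdim hm
    have h2 := Module.natCard_eq_pow_finrank (K := F) (V := LinearMap.ker (componentMap f m))
    rw [Nat.sub_mul, show (h + 1) * finrank F A - s * finrank F A =
      finrank F (LinearMap.ker (componentMap f m)) by omega, ← h2]
    exact (Nat.subtype_card _ (by simp)).symm
  by_contra hno
  push Not at hno
  have hcover : (Finset.univ.filter fun a => a ∈ LinearMap.ker (componentMap f l)) ⊆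
      (Finset.univ.filter fun m => m ∉ Submodule.span F (Set.range l)).biUnion fun m =>
        Finset.univ.filter fun a => a ∈ LinearMap.ker
          (componentMap f (Fin.snoc l m : Fin (i + 1) → Dual F K)) := by
    intro a ha
    have ha' : ∀ j u, l j (a (f u)) = 0 := by
      intro j u
      have := (Finset.mem_filter.1 ha).2
      exact LinearMap.congr_fun (congrFun this j) u
    have hle : Submodule.span F (Set.range l) ≤
        (LinearMap.range (pullDual f a)).dualAnnihilator := by
      rw [Submodule.span_le]
      rintro _ ⟨j, rfl⟩
      rw [SetLike.mem_coe, Submodule.mem_dualAnnihilator]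
      rintro _ ⟨u, rfl⟩
      exact ha' j u
    have hne : Submodule.span F (Set.range l) ≠
        (LinearMap.range (pullDual f a)).dualAnnihilator := by
      intro heq
      have h1 := finrank_range_add_annihilator (pullDual f a)
      rw [← heq, finrank_span_eq_card hl, Fintype.card_fin] at h1
      exact hno a h1
    obtain ⟨m, hm, hml⟩ := SetLike.exists_of_lt (lt_of_le_of_ne hle hne)
    refine Finset.mem_biUnion.2 ⟨m, by simpa using hml, ?_⟩
    refine Finset.mem_filter.2 ⟨Finset.mem_univ _, ?_⟩
    ext j u
    refine Fin.lastCases ?_ (fun j => ?_) j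
    · simpa using (Submodule.mem_dualAnnihilator _).1 hm _ ⟨u, rfl⟩
    · simpa using ha' j u
  have hle := (Finset.card_le_card hcover).trans Finset.card_biUnion_le
  rw [hcard l hl (by omega), Finset.sum_congr rfl fun m hm => hcard _
    (linearIndependent_finSnoc.2 ⟨hl, (Finset.mem_filter.1 hm).2⟩) (by omega), Finset.sum_const,
    smul_eq_mul] at hle
  have hlt : (Finset.univ.filter fun m => m ∉ Submodule.span F (Set.range l)).card <
      Nat.card F ^ finrank F K := by
    rw [← Subspace.dual_finrank_eq (K := F) (V := K), ← Module.natCard_eq_pow_finrank,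
      Nat.card_eq_fintype_card]
    -- The functional 0 lies in the span, which makes the inequality strict.
    refine Finset.card_lt_univ_of_notMem (x := 0) ?_
    simp
  have hpow : Nat.card F ^ ((h + 1 - i) * finrank F A) =
      Nat.card F ^ finrank F A * Nat.card F ^ ((h + 1 - (i + 1)) * finrank F A) := by
    rw [← pow_add]
    congr 1
    rw [show h + 1 - i = (h + 1 - (i + 1)) + 1 by omega]
    ring
  rw [hpow] at hle
  have h3 := Nat.le_of_mul_le_mul_right hle (by positivity)
  exact absurd (h3.trans_lt hlt) (not_lt.2 (Nat.pow_le_pow_right (by omega) hnk))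

end RankCode

/-! ### Scatteredness as preservation of linear independence. -/

section Scattered

variable {F K V : Type*} [Field F] [Field K] [Algebra F K]
  [AddCommGroup V] [Module K V] [Module F V] [IsScalarTower F K V]

theorem IsHScattered.le {h : ℕ} {S : Submodule K V} {U : Submodule F V}
    (hU : IsHScattered h S U) : U ≤ S.restrictScalars F := fun x hx => by
  have := hU.2.2.1
  rw [Submodule.restrictScalars_mem, ← this]
  exact Submodule.subset_span hx

theorem span_span_eq (T : Set V) :
    Submodule.span K (Submodule.span F T : Set V) = Submodule.span K T :=
  Submodule.span_span_of_tower F K T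

theorem IsHScattered.finrank_le [FiniteDimensional F V] {h : ℕ} {S : Submodule K V}
    {U : Submodule F V} (hU : IsHScattered h S U) : finrank K S ≤ finrank F U := by
  let b := finBasis F U
  have h1 : Submodule.span K (Set.range fun i => (b i : V)) = S := by
    rw [← hU.2.2.1, ← span_span_eq (F := F)]
    congr 2
    have := congrArg (Submodule.map U.subtype) b.span_eq
    rw [Submodule.map_span, Submodule.map_top, Submodule.range_subtype, ← Set.range_comp] at this
    exact this
  have h2 := finrank_range_le_card (R := K) fun i => (b i : V)
  rw [Set.finrank, h1] at h2
  simpa using h2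

theorem IsHScattered.linearIndependent [FiniteDimensional F V] [FiniteDimensional K V] {h : ℕ}
    {S : Submodule K V} {U : Submodule F V} (hU : IsHScattered h S U) {e : Fin (h + 1) → V}
    (heU : ∀ i, e i ∈ U) (he : LinearIndependent F e) : LinearIndependent K e := by
  rw [linearIndependent_iff_card_eq_finrank_span, Fintype.card_fin]
  refine le_antisymm ?_ (by simpa using finrank_range_le_card (R := K) e)
  by_contra hlt
  rw [Set.finrank, not_le] at hlt
  have hleS : Submodule.span K (Set.range e) ≤ S := by
    rw [Submodule.span_le]
    rintro _ ⟨i, rfl⟩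
    exact hU.le (heU i)
  let N := (Submodule.span K (Set.range e)).comap S.subtype
  have hN : finrank K N = finrank K (Submodule.span K (Set.range e)) :=
    (Submodule.comapSubtypeEquivOfLe hleS).finrank_eq
  -- The weight bound concerns subspaces of dimension exactly h, so the span, of dimension at most
  -- h, is first enlarged inside `S`; it then contains h+1 independent vectors of `U`.
  obtain ⟨T, hNT, hT⟩ := exists_le_finrank_eq N h (by omega) (by have := hU.2.1; omega)
  have hW := hU.2.2.2 (T.map S.subtype) (Submodule.map_subtype_le _ _)
    ((Submodule.finrank_map_subtype_eq _ _).trans hT)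
  have hle : Submodule.span F (Set.range e) ≤
      U ⊓ (T.map S.subtype).restrictScalars F := by
    rw [Submodule.span_le]
    rintro _ ⟨i, rfl⟩
    refine ⟨heU i, ?_⟩
    rw [SetLike.mem_coe, Submodule.restrictScalars_mem]
    exact ⟨⟨e i, hU.le (heU i)⟩, hNT (Submodule.subset_span ⟨i, rfl⟩), rfl⟩
  have h1 := Submodule.finrank_mono hle
  rw [finrank_span_eq_card he, Fintype.card_fin] at h1
  omega

end Scattered

/-! ### Passing to shorter independent families. -/

section Independence

variable {F K S A : Type*} [Field F] [Field K] [Algebra F K]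
  [AddCommGroup S] [Module K S] [Module F S] [IsScalarTower F K S]
  [AddCommGroup A] [Module F A]

omit [Algebra F K] [IsScalarTower F K S] in
theorem IndependencePreserving.mono [FiniteDimensional F A] {f : A →ₗ[F] S} {s t : ℕ}
    (hf : IndependencePreserving K f t) (hst : s ≤ t) (ht : t ≤ finrank F A) :
    IndependencePreserving K f s := by
  induction t, hst using Nat.le_induction with
  | base => exact hf
  | succ t hst ih =>
    refine ih (fun e he => ?_) (by omega)
    obtain ⟨x, hx⟩ := exists_linearIndependent_snoc_of_lt_finrank he ht
    simpa [Function.comp_def] using (hf _ hx).comp Fin.castSucc (Fin.castSucc_injective t)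

end Independence

/-! ### Counting points and vectors, and fibres of a functional. -/

section PointCounts

variable {F K V : Type*} [Field F] [Field K] [Algebra F K]
  [AddCommGroup V] [Module K V] [Module F V] [IsScalarTower F K V]

/-- Every point of `L_U` has weight one: since h ≥ 1, pairs independent over F stay independent over
K. -/
theorem IsHScattered.exists_smul_eq [FiniteDimensional F V] [FiniteDimensional K V] {h : ℕ}
    {S : Submodule K V} {U : Submodule F V} (hU : IsHScattered h S U) {u v : V} (hu : u ∈ U)
    (hv : v ∈ U) (hv0 : v ≠ 0) {c : K} (huv : u = c • v) : ∃ a : F, u = a • v := by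
  have hf : IndependencePreserving K U.subtype (h + 1) := fun e he =>
    hU.linearIndependent (fun i => (e i).2) he.submoduleCoe
  have h2 := hf.mono (s := 2) (by have := hU.1; omega) (hU.2.1.trans hU.finrank_le)
  by_contra hno
  push Not at hno
  have hind : LinearIndependent F ![(⟨v, hv⟩ : U), ⟨u, hu⟩] := by
    rw [LinearIndependent.pair_iff' (by simpa using hv0)]
    intro a ha
    exact hno a (congrArg Subtype.val ha).symm
  have h3 := Fintype.linearIndependent_iff.1 (h2 _ hind) ![c, -1] (by simp [huv]) 1
  simp at h3

theorem mk_mem_subspacePoints {W : Submodule K V} {v : V} (hv : v ≠ 0) :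
    Projectivization.mk K v hv ∈ subspacePoints W ↔ v ∈ W := by
  simp [subspacePoints, Projectivization.submodule_mk, Submodule.span_singleton_le_iff_mem]

omit [Algebra F K] [IsScalarTower F K V] in
theorem mk_mem_linearSet {A : Submodule F V} {v : V} (hv : v ≠ 0) :
    Projectivization.mk K v hv ∈ linearSet K A ↔ ∃ c : K, ∃ u ∈ A, v = c • u := by
  constructor
  · rintro ⟨u, huA, hu, h⟩
    obtain ⟨c, hc⟩ := (Projectivization.mk_eq_mk_iff' K v u hv hu).1 h
    exact ⟨c, u, huA, hc.symm⟩
  · rintro ⟨c, u, huA, h⟩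
    have hu : u ≠ 0 := by
      rintro rfl
      simp [hv] at h
    exact ⟨u, huA, hu, (Projectivization.mk_eq_mk_iff' K v u hv hu).2 ⟨c, h.symm⟩⟩

/-- The nonzero vectors that represent the points of `P`. -/
def representatives (P : Set (ℙ K V)) : Set V :=
  {v | ∃ hv : v ≠ 0, Projectivization.mk K v hv ∈ P}

/-- Passing from points to vectors turns cones into sums of sets, at the cost of a factor |K| - 1.
-/
theorem ncard_representatives [Finite K] (P : Set (ℙ K V)) :
    (representatives P).ncard = (Nat.card K - 1) * P.ncard := by
  let g : P × Kˣ → V := fun x => x.2 • (x.1 : ℙ K V).rep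
  have hg0 : ∀ x, g x ≠ 0 := fun x =>
    (smul_ne_zero_iff_ne x.2).2 (Projectivization.rep_nonzero _)
  have hmk : ∀ x, Projectivization.mk K (g x) (hg0 x) = x.1 := fun x => by
    conv_rhs => rw [← Projectivization.mk_rep (x.1 : ℙ K V)]
    exact (Projectivization.mk_eq_mk_iff K _ _ _ _).2 ⟨x.2, rfl⟩
  have hg : Function.Injective g := by
    rintro ⟨p, a⟩ ⟨p', a'⟩ h
    have hp : p = p' := by
      apply Subtype.ext
      rw [← hmk (p, a), ← hmk (p', a')]
      simp only [h]
    subst hp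
    have h' : (a : K) • (p : ℙ K V).rep = (a' : K) • (p : ℙ K V).rep := h
    have := smul_left_injective K (Projectivization.rep_nonzero (p : ℙ K V)) h'
    rw [Units.ext this]
  have hr : Set.range g = representatives P := by
    ext v
    constructor
    · rintro ⟨x, rfl⟩
      exact ⟨hg0 x, by rw [hmk]; exact x.1.2⟩
    · rintro ⟨hv, hP⟩
      obtain ⟨a, ha⟩ := Projectivization.exists_smul_eq_mk_rep K v hv
      exact ⟨(⟨_, hP⟩, a⁻¹), by simp [g, ← ha]⟩
  rw [← hr, ← Nat.card_coe_set_eq, ← Nat.card_congr (Equiv.ofInjective g hg), Nat.card_prod,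
    Nat.card_units, Nat.card_coe_set_eq, mul_comm]

/-- `hA` says that all weights are one, so the points of PG(A, F) correspond bijectively to those of
the linear set. -/
theorem ncard_linearSet [Finite F] {A : Submodule F V}
    (hA : ∀ u ∈ A, ∀ v ∈ A, v ≠ 0 → ∀ c : K, u = c • v → ∃ a : F, u = a • v) :
    (linearSet K A).ncard = ∑ i ∈ Finset.range (finrank F A), Nat.card F ^ i := by
  rw [← Projectivization.card_of_finrank F A rfl]
  have h0 : ∀ p : ℙ F A, (p.rep : V) ≠ 0 := fun p => by
    simpa using Projectivization.rep_nonzero p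
  let g : ℙ F A → ℙ K V := fun p => Projectivization.mk K (p.rep : V) (h0 p)
  have hg : Function.Injective g := by
    intro p p' h
    obtain ⟨c, hc⟩ := (Projectivization.mk_eq_mk_iff' K _ _ (h0 p) (h0 p')).1 h
    obtain ⟨a, ha⟩ := hA _ p.rep.2 _ p'.rep.2 (h0 p') c hc.symm
    rw [← Projectivization.mk_rep p, ← Projectivization.mk_rep p']
    exact (Projectivization.mk_eq_mk_iff' F _ _ _ _).2 ⟨a, Subtype.ext ha.symm⟩
  have hr : Set.range g = linearSet K A := by
    ext x
    constructor
    · rintro ⟨p, rfl⟩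
      exact ⟨_, p.rep.2, h0 p, rfl⟩
    · rintro ⟨u, huA, hu, rfl⟩
      have hu' : (⟨u, huA⟩ : A) ≠ 0 := by simpa using hu
      refine ⟨Projectivization.mk F ⟨u, huA⟩ hu', ?_⟩
      obtain ⟨a, ha⟩ := Projectivization.exists_smul_eq_mk_rep F (⟨u, huA⟩ : A) hu'
      refine (Projectivization.mk_eq_mk_iff' K _ _ _ _).2 ⟨algebraMap F K a, ?_⟩
      rw [← ha, algebraMap_smul]
      rfl
  rw [← hr, ← Nat.card_coe_set_eq, Nat.card_congr (Equiv.ofInjective g hg).symm]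

theorem ncard_subspacePoints [Finite K] (W : Submodule K V) :
    (subspacePoints W).ncard = ∑ i ∈ Finset.range (finrank K W), Nat.card K ^ i := by
  have h1 : subspacePoints W = linearSet K W := by
    ext p
    induction p using Projectivization.ind with
    | h v hv =>
      rw [mk_mem_subspacePoints, mk_mem_linearSet]
      exact ⟨fun h => ⟨1, v, h, by simp⟩, by rintro ⟨c, u, hu, rfl⟩; exact W.smul_mem c hu⟩
  rw [h1]
  exact ncard_linearSet fun u _ v _ _ c h => ⟨c, h⟩

theorem linearSet_subset_subspacePoints {A : Submodule F V} {W : Submodule K V}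
    (h : A ≤ W.restrictScalars F) : linearSet K A ⊆ subspacePoints W := by
  rintro _ ⟨u, hu, hu0, rfl⟩
  exact (mk_mem_subspacePoints hu0).2 (h hu)

open scoped Pointwise

theorem ncard_add_of_le_ker [Finite V] {S₁ S₂ : Submodule K V} (hdisj : Disjoint S₁ S₂)
    {B : Set V} (hB : B ⊆ S₁) {φ : Dual K V} (hφ : S₂ ≤ LinearMap.ker φ) (c : K) :
    ((B + (S₂ : Set V)) ∩ {v | φ v = c}).ncard = (B ∩ {v | φ v = c}).ncard * Nat.card S₂ := by
  have himg : (B + (S₂ : Set V)) ∩ {v | φ v = c} =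
      (fun x : V × V => x.1 + x.2) '' ((B ∩ {v | φ v = c}) ×ˢ (S₂ : Set V)) := by
    ext v
    constructor
    · rintro ⟨⟨b, hb, s, hs, rfl⟩, hv⟩
      refine ⟨(b, s), ⟨⟨hb, ?_⟩, hs⟩, rfl⟩
      have := LinearMap.mem_ker.1 (hφ hs)
      simpa [this] using hv
    · rintro ⟨⟨b, s⟩, ⟨⟨hb, hbc⟩, hs⟩, rfl⟩
      refine ⟨⟨b, hb, s, hs, rfl⟩, ?_⟩
      have := LinearMap.mem_ker.1 (hφ hs)
      simpa [this] using hbc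
  rw [himg, Set.InjOn.ncard_image, Set.ncard_prod, ← Nat.card_coe_set_eq (S₂ : Set V)]
  · rfl
  · rintro ⟨b, s⟩ ⟨⟨hb, -⟩, hs⟩ ⟨b', s'⟩ ⟨⟨hb', -⟩, hs'⟩ h
    have h1 : b - b' = s' - s := by
      have : b + s = b' + s' := h
      rw [sub_eq_sub_iff_add_eq_add, this, add_comm]
    have h2 : b - b' = 0 := Submodule.disjoint_def.1 hdisj _ (S₁.sub_mem (hB hb) (hB hb'))
      (h1 ▸ S₂.sub_mem hs' hs)
    have h3 : s' - s = 0 := h1 ▸ h2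
    exact Prod.ext (sub_eq_zero.1 h2) (sub_eq_zero.1 h3).symm

theorem ncard_add_of_not_le_ker [Finite V] {S₁ S₂ : Submodule K V} (hdisj : Disjoint S₁ S₂)
    {B : Set V} (hB : B ⊆ S₁) {φ : Dual K V} (hφ : ¬ S₂ ≤ LinearMap.ker φ) (c : K) :
    ((B + (S₂ : Set V)) ∩ {v | φ v = c}).ncard * Nat.card K = B.ncard * Nat.card S₂ := by
  obtain ⟨s₀, hs₀, hφs⟩ := SetLike.not_le_iff_exists.1 hφ
  rw [LinearMap.mem_ker] at hφs
  have h0 := ncard_add_of_le_ker hdisj hB (φ := 0) (by simp) 0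
  simp only [LinearMap.zero_apply, Set.ofPred_true, Set.inter_univ] at h0
  rw [← h0, ← Set.ncard_univ, ← Set.ncard_prod]
  -- Translation by the multiple of `s₀` with φ-value t preserves B + S₂ and carries the fibre over
  -- c to the fibre over c + t.
  refine Set.ncard_congr (fun x _ => x.1 + (x.2 / φ s₀) • s₀) ?_ ?_ ?_
  · rintro ⟨v, t⟩ ⟨⟨⟨b, hb, s, hs, rfl⟩, -⟩, -⟩
    exact ⟨b, hb, s + (t / φ s₀) • s₀, S₂.add_mem hs (S₂.smul_mem _ hs₀), by simp [add_assoc]⟩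
  · rintro ⟨v, t⟩ ⟨v', t'⟩ ⟨⟨-, hv⟩, -⟩ ⟨⟨-, hv'⟩, -⟩ h
    have hv1 : φ v = c := hv
    have hv1' : φ v' = c := hv'
    have ht : t = t' := by
      have := congrArg φ h
      simpa [hv1, hv1', hφs] using this
    subst ht
    simpa using h
  · rintro _ ⟨b, hb, s, hs, rfl⟩
    refine ⟨(b + (s - ((φ (b + s) - c) / φ s₀) • s₀), φ (b + s) - c),
      ⟨⟨⟨b, hb, _, S₂.sub_mem hs (S₂.smul_mem _ hs₀), rfl⟩, ?_⟩, trivial⟩, ?_⟩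
    · simp [hφs]
      ring
    · simp [add_assoc]

theorem ncard_inter_fiber [Finite V] [Finite F] (A : Submodule F V) (φ : Dual K V) (c : K) :
    ((∃ u ∈ A, φ u = c) → ((A : Set V) ∩ {v | φ v = c}).ncard =
      Nat.card F ^ finrank F (A ⊓ (LinearMap.ker φ).restrictScalars F : Submodule F V)) ∧
    ((¬ ∃ u ∈ A, φ u = c) → ((A : Set V) ∩ {v | φ v = c}).ncard = 0) := by
  have : Module.Finite F V := Module.Finite.of_finite
  constructor
  · rintro ⟨u, hu, rfl⟩
    rw [← Module.natCard_eq_pow_finrank, ← SetLike.coe_sort_coe, Nat.card_coe_set_eq]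
    refine Set.ncard_congr (fun v _ => v - u) ?_ ?_ ?_
    · rintro v ⟨hv, hφ⟩
      refine ⟨A.sub_mem hv hu, ?_⟩
      have : φ v = φ u := hφ
      simp [this]
    · intro v w _ _ h
      simpa using h
    · rintro v ⟨hv, hφ⟩
      have : φ v = 0 := hφ
      exact ⟨v + u, ⟨A.add_mem hv hu, by simp [this]⟩, by simp⟩
  · intro h
    have : (A : Set V) ∩ {v | φ v = c} = ∅ := by
      rw [Set.eq_empty_iff_forall_notMem]
      rintro v ⟨hv, hφ⟩
      exact h ⟨v, hv, hφ⟩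
    rw [this, Set.ncard_empty]

end PointCounts

/-! ### The cone, the affine points, and the representatives at infinity. -/

section Switched

variable {F K V : Type*} [Field F] [Field K] [Algebra F K]
  [AddCommGroup V] [Module K V] [Module F V] [IsScalarTower F K V]

theorem linearSet_eq_projectiveCone {S₂ : Submodule K V} {U₁ : Submodule F V}
    (hU₁ : ∃ u ∈ U₁, u ≠ 0) :
    linearSet K (U₁ ⊔ S₂.restrictScalars F) = projectiveCone S₂ (linearSet K U₁) := by
  ext p
  induction p using Projectivization.ind with
  | h v hv =>
  simp only [projectiveCone, Set.mem_iUnion, exists_prop, mk_mem_subspacePoints]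
  rw [mk_mem_linearSet]
  constructor
  · rintro ⟨c, w, hw, rfl⟩
    obtain ⟨u, hu, s, hs, rfl⟩ := Submodule.mem_sup.1 hw
    rw [Submodule.restrictScalars_mem] at hs
    by_cases hu0 : u = 0
    · obtain ⟨u', hu', hu'0⟩ := hU₁
      refine ⟨_, ⟨u', hu', hu'0, rfl⟩, Submodule.mem_sup_right ?_⟩
      simpa [hu0] using S₂.smul_mem c hs
    · refine ⟨_, ⟨u, hu, hu0, rfl⟩, Submodule.smul_mem _ _ (Submodule.add_mem_sup ?_ hs)⟩
      simp
  · rintro ⟨_, ⟨u, hu, hu0, rfl⟩, h⟩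
    rw [Projectivization.submodule_mk] at h
    obtain ⟨w, hw, s, hs, rfl⟩ := Submodule.mem_sup.1 h
    obtain ⟨c, rfl⟩ := Submodule.mem_span_singleton.1 hw
    by_cases hc : c = 0
    · exact ⟨1, s, Submodule.mem_sup_right hs, by simp [hc]⟩
    · exact ⟨c, u + c⁻¹ • s, Submodule.add_mem_sup hu (S₂.smul_mem _ hs), by simp [hc]⟩

variable {E : Submodule K V} {U : Submodule F V} {y : V}

omit [Algebra F K] [IsScalarTower F K V] in
theorem switchedSet_inter_subspacePoints
    (H : Submodule K V) :
    switchedSet E U y ∩ subspacePoints H ∩ subspacePoints E =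
      subspacePoints (E ⊓ H) \ linearSet K U := by
  ext p
  induction p using Projectivization.ind with
  | h v hv =>
  simp only [switchedSet, Set.mem_inter_iff, Set.mem_union, Set.mem_sdiff, mk_mem_subspacePoints,
    Submodule.mem_inf]
  constructor
  · rintro ⟨⟨(⟨-, h⟩ | ⟨-, h⟩), hH⟩, hE⟩ <;> exact ⟨⟨hE, hH⟩, h⟩
  · rintro ⟨⟨hE, hH⟩, h⟩
    exact ⟨⟨Or.inr ⟨hE, h⟩, hH⟩, hE⟩

/-- An affine point of the set has exactly one representative u + y with u in `U`, as `y` lies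
outside `E`; it lies in ker φ when φ(u) = -φ(y). -/
theorem ncard_switchedSet_diff_subspacePoints (hU : U ≤ E.restrictScalars F) (hy : y ∉ E)
    (φ : Dual K V) :
    ((switchedSet E U y ∩ subspacePoints (LinearMap.ker φ)) \ subspacePoints E).ncard =
      ((U : Set V) ∩ {v | φ v = -φ y}).ncard := by
  have hne : ∀ u ∈ U, u + y ≠ 0 := fun u hu h => by
    refine hy ?_
    rw [← neg_eq_of_add_eq_zero_right h]
    exact E.neg_mem (hU hu)
  have hnE : ∀ u ∈ U, u + y ∉ E := fun u hu h => hy ((E.add_mem_iff_right (hU hu)).1 h)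
  symm
  refine Set.ncard_congr (fun u hu => Projectivization.mk K (u + y) (hne u hu.1)) ?_ ?_ ?_
  · rintro u ⟨hu, hφ⟩
    refine ⟨⟨Or.inl ⟨⟨u + y, Submodule.add_mem_sup hu (Submodule.mem_span_singleton_self y),
      hne u hu, rfl⟩, ?_⟩, ?_⟩, ?_⟩
    · intro h
      exact hnE u hu ((mk_mem_subspacePoints _).1 (linearSet_subset_subspacePoints hU h))
    · rw [mk_mem_subspacePoints, LinearMap.mem_ker, map_add, show φ u = -φ y from hφ,
        neg_add_cancel]
    · intro h
      exact hnE u hu ((mk_mem_subspacePoints _).1 h)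
  · rintro u w ⟨hu, _⟩ ⟨hw, _⟩ h
    obtain ⟨c, hc⟩ := (Projectivization.mk_eq_mk_iff' K _ _ (hne u hu) (hne w hw)).1 h
    have hc1 : (c - 1) • y = u - c • w := by
      rw [sub_smul, one_smul, sub_eq_sub_iff_add_eq_add, ← hc, smul_add, add_comm]
    have : c - 1 = 0 := by
      by_contra h0
      refine hy ((E.smul_mem_iff h0).1 ?_)
      rw [hc1]
      exact E.sub_mem (hU hu) (E.smul_mem c (hU hw))
    rw [sub_eq_zero.1 this, one_smul] at hc
    exact (add_right_cancel hc).symm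
  · rintro p ⟨⟨hp, hH⟩, hE⟩
    rcases hp with ⟨⟨w, hw, hw0, rfl⟩, -⟩ | ⟨h, -⟩
    · rw [mk_mem_subspacePoints] at hH hE
      obtain ⟨u, hu, z, hz, rfl⟩ := Submodule.mem_sup.1 hw
      obtain ⟨a, rfl⟩ := Submodule.mem_span_singleton.1 hz
      have ha : a ≠ 0 := by
        rintro rfl
        exact hE (by simpa using hU hu)
      have haK : algebraMap F K a ≠ 0 := by simpa using ha
      have hsm : algebraMap F K a • (a⁻¹ • u + y) = u + a • y := by
        rw [algebraMap_smul, smul_add, smul_inv_smul₀ ha]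
      refine ⟨a⁻¹ • u, ⟨U.smul_mem _ hu, ?_⟩,
        (Projectivization.mk_eq_mk_iff' K _ _ _ _).2 ⟨(algebraMap F K a)⁻¹, ?_⟩⟩
      · have h1 : φ (a⁻¹ • u + y) = 0 := by
          rw [← hsm, LinearMap.mem_ker, map_smul, smul_eq_mul] at hH
          exact (mul_eq_zero.1 hH).resolve_left haK
        rw [map_add] at h1
        exact eq_neg_of_add_eq_zero_left h1
      · rw [← hsm, inv_smul_smul₀ haK]
    · exact absurd h hE

open scoped Pointwise

/-- For b in `S₁` and s in `S₂`, the vector b + s is a K-multiple of an element of U₁ + S₂ exactly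
when b is one of an element of `U₁`. In particular b = 0 never occurs on the right. -/
theorem representatives_diff_linearSet {S₁ S₂ : Submodule K V} {U₁ : Submodule F V}
    (hle : U₁ ≤ S₁.restrictScalars F) (hdisj : Disjoint S₁ S₂) (φ : Dual K V) :
    representatives (subspacePoints ((S₁ ⊔ S₂) ⊓ LinearMap.ker φ) \
        linearSet K (U₁ ⊔ S₂.restrictScalars F)) =
      (representatives (subspacePoints S₁ \ linearSet K U₁) + (S₂ : Set V)) ∩ {v | φ v = 0} := by
  ext v
  constructor
  · rintro ⟨hv, h, hL⟩
    rw [mk_mem_subspacePoints] at h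
    obtain ⟨b, hb, s, hs, rfl⟩ := Submodule.mem_sup.1 h.1
    rw [mk_mem_linearSet] at hL
    have hb' : ¬ ∃ c : K, ∃ u ∈ U₁, b = c • u := by
      rintro ⟨c, u, hu, rfl⟩
      refine hL ?_
      by_cases hc : c = 0
      · exact ⟨1, s, Submodule.mem_sup_right hs, by simp [hc]⟩
      · exact ⟨c, u + c⁻¹ • s, Submodule.add_mem_sup hu (S₂.smul_mem _ hs), by simp [hc]⟩
    have hb0 : b ≠ 0 := by
      rintro rfl
      exact hb' ⟨0, 0, U₁.zero_mem, by simp⟩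
    exact ⟨⟨b, ⟨hb0, (mk_mem_subspacePoints _).2 hb, fun hm => hb' ((mk_mem_linearSet _).1 hm)⟩,
      s, hs, rfl⟩, h.2⟩
  · rintro ⟨⟨b, ⟨hb0, hb, hbL⟩, s, hs, rfl⟩, hφ⟩
    rw [mk_mem_subspacePoints] at hb
    rw [mk_mem_linearSet] at hbL
    have hL : ¬ ∃ c : K, ∃ u ∈ U₁ ⊔ S₂.restrictScalars F, b + s = c • u := by
      rintro ⟨c, w, hw, h⟩
      obtain ⟨u, hu, z, hz, rfl⟩ := Submodule.mem_sup.1 hw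
      rw [Submodule.restrictScalars_mem] at hz
      refine hbL ⟨c, u, hu, ?_⟩
      have h1 : b - c • u = c • z - s := by
        rw [sub_eq_sub_iff_add_eq_add, h, smul_add, add_comm]
      exact sub_eq_zero.1 (Submodule.disjoint_def.1 hdisj _ (S₁.sub_mem hb (S₁.smul_mem c (hle hu)))
        (h1 ▸ S₂.sub_mem (S₂.smul_mem c hz) hs))
    have hv : b + s ≠ 0 := fun h => hL ⟨0, 0, Submodule.zero_mem _, by simp [h]⟩
    exact ⟨hv, (mk_mem_subspacePoints hv).2 ⟨Submodule.add_mem_sup hb hs, hφ⟩,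
      fun hm => hL ((mk_mem_linearSet hv).1 hm)⟩

theorem representatives_diff_linearSet_inter {S₁ : Submodule K V} {U₁ : Submodule F V}
    (φ : Dual K V) :
    representatives (subspacePoints S₁ \ linearSet K U₁) ∩ {v | φ v = 0} =
      representatives (subspacePoints (S₁ ⊓ LinearMap.ker φ) \
        linearSet K (U₁ ⊓ (LinearMap.ker φ).restrictScalars F)) := by
  ext v
  by_cases hv : v = 0
  · simp [representatives, hv]
  simp only [representatives, Set.mem_inter_iff, Set.mem_ofPred_eq, Set.mem_sdiff,
    mk_mem_subspacePoints, mk_mem_linearSet, Submodule.mem_inf, LinearMap.mem_ker]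
  constructor
  · rintro ⟨⟨hv, hS, hL⟩, hφ⟩
    exact ⟨hv, ⟨hS, hφ⟩, fun ⟨c, u, hu, h⟩ => hL ⟨c, u, hu.1, h⟩⟩
  · rintro ⟨hv, ⟨hS, hφ⟩, hL⟩
    refine ⟨⟨hv, hS, ?_⟩, hφ⟩
    rintro ⟨c, u, hu, h⟩
    refine hL ⟨c, u, ⟨hu, ?_⟩, h⟩
    have hc : c ≠ 0 := by
      rintro rfl
      simp [hv] at h
    rw [h, map_smul, smul_eq_mul] at hφ
    exact (mul_eq_zero.1 hφ).resolve_left hc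

end Switched

/-! ### Points at infinity and affine points in a hyperplane. -/

section Counting

variable {F K V : Type*} [Field F] [Finite F] [Field K] [Finite K] [Algebra F K]
  [AddCommGroup V] [Module K V] [Module F V] [IsScalarTower F K V] [Finite V]

theorem qBracket_eq_natCast (q k : ℕ) :
    qBracket q k = ((∑ i ∈ Finset.range k, q ^ i : ℕ) : ℤ) := by
  simp [qBracket]

theorem ncard_subspacePoints_diff_linearSet {W : Submodule K V} {A : Submodule F V}
    (hAW : A ≤ W.restrictScalars F)
    (hA : ∀ u ∈ A, ∀ v ∈ A, v ≠ 0 → ∀ c : K, u = c • v → ∃ a : F, u = a • v) :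
    ((subspacePoints W \ linearSet K A).ncard : ℤ) =
      qBracket (Nat.card K) (finrank K W) - qBracket (Nat.card F) (finrank F A) := by
  rw [Set.cast_ncard_sdiff (linearSet_subset_subspacePoints hAW) (Set.toFinite _),
    ncard_subspacePoints, ncard_linearSet hA, qBracket_eq_natCast, qBracket_eq_natCast]

variable {h : ℕ} {S₁ S₂ : Submodule K V} {U₁ : Submodule F V} {y : V}

omit [Finite F] [Finite K] in
theorem IsHScattered.exists_smul_eq_inf (hU : IsHScattered h S₁ U₁) (A : Submodule F V) :
    ∀ u ∈ U₁ ⊓ A, ∀ v ∈ U₁ ⊓ A, v ≠ 0 → ∀ c : K, u = c • v → ∃ a : F, u = a • v := by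
  have : Module.Finite F V := Module.Finite.of_finite
  have : Module.Finite K V := Module.Finite.of_finite
  exact fun u hu v hv hv0 c huv => hU.exists_smul_eq hu.1 hv.1 hv0 huv

omit [Finite F] [Finite K] [Finite V] in
theorem sup_le_restrictScalars (hle : U₁ ≤ S₁.restrictScalars F) :
    U₁ ⊔ S₂.restrictScalars F ≤ (S₁ ⊔ S₂).restrictScalars F :=
  sup_le (fun _ hx => Submodule.mem_sup_left (hle hx)) (fun _ hx => Submodule.mem_sup_right hx)

omit [Finite F] [Finite K] [Finite V] [Algebra F K] [IsScalarTower F K V] in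
theorem representatives_subset (U₁ : Submodule F V) :
    representatives (subspacePoints S₁ \ linearSet K U₁) ⊆ S₁ := by
  rintro v ⟨hv, hS, -⟩
  exact (mk_mem_subspacePoints hv).1 hS

theorem ncard_at_infinity_of_le_ker (hU : IsHScattered h S₁ U₁) (hdisj : Disjoint S₁ S₂)
    {φ : Dual K V} (hφ : S₂ ≤ LinearMap.ker φ) :
    ((switchedSet (S₁ ⊔ S₂) (U₁ ⊔ S₂.restrictScalars F) y ∩ subspacePoints (LinearMap.ker φ) ∩
        subspacePoints (S₁ ⊔ S₂)).ncard : ℤ) =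
      Nat.card S₂ * (qBracket (Nat.card K) (finrank K (S₁ ⊓ LinearMap.ker φ : Submodule K V)) -
        qBracket (Nat.card F)
          (finrank F (U₁ ⊓ (LinearMap.ker φ).restrictScalars F : Submodule F V))) := by
  have hq : 1 < Nat.card K := Finite.one_lt_card
  have h1 := ncard_representatives (subspacePoints ((S₁ ⊔ S₂) ⊓ LinearMap.ker φ) \
    linearSet K (U₁ ⊔ S₂.restrictScalars F))
  rw [representatives_diff_linearSet hU.le hdisj, ncard_add_of_le_ker hdisj
    (representatives_subset U₁) hφ, representatives_diff_linearSet_inter, ncard_representatives,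
    mul_assoc] at h1
  have hle : U₁ ⊓ (LinearMap.ker φ).restrictScalars F ≤
      (S₁ ⊓ LinearMap.ker φ).restrictScalars F := fun x hx => ⟨hU.le hx.1, hx.2⟩
  rw [switchedSet_inter_subspacePoints, ← Nat.eq_of_mul_eq_mul_left (by omega) h1, Nat.cast_mul,
    mul_comm, ncard_subspacePoints_diff_linearSet hle (hU.exists_smul_eq_inf _)]

/-- Multiplying by |K| avoids a division; |K| is cancelled later, once dim S₂ ≥ 1 makes it a factor
of |S₂|. -/
theorem ncard_at_infinity_of_not_le_ker (hU : IsHScattered h S₁ U₁) (hdisj : Disjoint S₁ S₂)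
    {φ : Dual K V} (hφ : ¬ S₂ ≤ LinearMap.ker φ) :
    ((switchedSet (S₁ ⊔ S₂) (U₁ ⊔ S₂.restrictScalars F) y ∩ subspacePoints (LinearMap.ker φ) ∩
        subspacePoints (S₁ ⊔ S₂)).ncard : ℤ) * Nat.card K =
      Nat.card S₂ * (qBracket (Nat.card K) (finrank K S₁) -
        qBracket (Nat.card F) (finrank F U₁)) := by
  have hq : 1 < Nat.card K := Finite.one_lt_card
  have h1 := ncard_representatives (subspacePoints ((S₁ ⊔ S₂) ⊓ LinearMap.ker φ) \
    linearSet K (U₁ ⊔ S₂.restrictScalars F))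
  have h2 := ncard_add_of_not_le_ker hdisj (representatives_subset (S₁ := S₁) U₁) hφ 0
  rw [← representatives_diff_linearSet hU.le hdisj, h1, ncard_representatives, mul_assoc,
    mul_assoc] at h2
  have h3 := Nat.eq_of_mul_eq_mul_left (by omega) h2
  rw [switchedSet_inter_subspacePoints, ← Nat.cast_mul, h3, Nat.cast_mul,
    mul_comm, ncard_subspacePoints_diff_linearSet hU.le
      (by simpa using hU.exists_smul_eq_inf ⊤)]

omit [Finite F] [Finite K] in
theorem ncard_affine_of_le_ker (hle : U₁ ≤ S₁.restrictScalars F) (hdisj : Disjoint S₁ S₂)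
    (hy : y ∉ S₁ ⊔ S₂) {φ : Dual K V} (hφ : S₂ ≤ LinearMap.ker φ) :
    ((switchedSet (S₁ ⊔ S₂) (U₁ ⊔ S₂.restrictScalars F) y ∩ subspacePoints (LinearMap.ker φ)) \
        subspacePoints (S₁ ⊔ S₂)).ncard =
      ((U₁ : Set V) ∩ {v | φ v = -φ y}).ncard * Nat.card S₂ := by
  rw [ncard_switchedSet_diff_subspacePoints (sup_le_restrictScalars hle) hy, Submodule.coe_sup,
    Submodule.coe_restrictScalars, ncard_add_of_le_ker hdisj hle hφ]

omit [Finite F] [Finite K] in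
theorem ncard_affine_of_not_le_ker (hle : U₁ ≤ S₁.restrictScalars F) (hdisj : Disjoint S₁ S₂)
    (hy : y ∉ S₁ ⊔ S₂) {φ : Dual K V} (hφ : ¬ S₂ ≤ LinearMap.ker φ) :
    ((switchedSet (S₁ ⊔ S₂) (U₁ ⊔ S₂.restrictScalars F) y ∩ subspacePoints (LinearMap.ker φ)) \
        subspacePoints (S₁ ⊔ S₂)).ncard * Nat.card K =
      Nat.card F ^ finrank F U₁ * Nat.card S₂ := by
  have : Module.Finite F V := Module.Finite.of_finite
  rw [ncard_switchedSet_diff_subspacePoints (sup_le_restrictScalars hle) hy, Submodule.coe_sup,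
    Submodule.coe_restrictScalars, ncard_add_of_not_le_ker hdisj hle hφ,
    ← Module.natCard_eq_pow_finrank, ← Nat.card_coe_set_eq]
  rfl

end Counting

/-! ### Weights of hyperplanes, and functionals with prescribed behaviour. -/

section Weights

variable {F K V : Type*} [Field F] [Finite F] [Field K] [Finite K] [Algebra F K]
  [AddCommGroup V] [Module K V] [Module F V] [IsScalarTower F K V] [Finite V]
  {h : ℕ} {S : Submodule K V} {U : Submodule F V}

/-- The inclusion of an `F`-subspace into a `K`-subspace. -/
def inclusionMap (hle : U ≤ S.restrictScalars F) : U →ₗ[F] S where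
  toFun u := ⟨u, hle u.2⟩
  map_add' _ _ := rfl
  map_smul' _ _ := rfl

omit [Finite F] [Finite K] in
theorem finrank_inf_ker_add_finrank_range (hle : U ≤ S.restrictScalars F) (φ : Dual K V) :
    finrank F (U ⊓ (LinearMap.ker φ).restrictScalars F : Submodule F V) +
      finrank F (LinearMap.range (pullDual (inclusionMap hle) (φ.domRestrict S))) =
        finrank F U := by
  have : Module.Finite F V := Module.Finite.of_finite
  have hker : LinearMap.ker (pullDual (inclusionMap hle) (φ.domRestrict S)) =
      ((LinearMap.ker φ).restrictScalars F).comap U.subtype := by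
    ext u
    rfl
  rw [← (pullDual (inclusionMap hle) (φ.domRestrict S)).finrank_range_add_finrank_ker, hker,
    add_comm, ← Submodule.map_comap_subtype, Submodule.finrank_map_subtype_eq]

omit [Finite F] [Finite K] in
theorem IsProperlyMaximumHScattered.independencePreserving
    (hU : IsProperlyMaximumHScattered h S U) :
    IndependencePreserving K (inclusionMap hU.1.le) (h + 1) := by
  have : Module.Finite F V := Module.Finite.of_finite
  have : Module.Finite K V := Module.Finite.of_finite
  intro e he
  have := hU.1.linearIndependent (fun i => (e i).2) he.submoduleCoe
  exact LinearIndependent.of_comp S.subtype this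

-- With (h+1)k = dn, the first bound follows from h+1 ≤ d and the second from d ≤ k.
omit [Finite F] [Finite K] in
theorem IsProperlyMaximumHScattered.bounds (hU : IsProperlyMaximumHScattered h S U) :
    finrank F K ≤ finrank F U ∧ h + 1 ≤ finrank F K ∧ h + 1 ≤ finrank F U := by
  have : Module.Finite F V := Module.Finite.of_finite
  have h1 := hU.1.finrank_le
  have h2 := hU.1.2.1
  have h3 := hU.2
  refine ⟨?_, ?_, by omega⟩
  · refine Nat.le_of_mul_le_mul_left ?_ (Nat.succ_pos h)
    exact (Nat.mul_le_mul_right _ h2).trans h3.ge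
  · refine Nat.le_of_mul_le_mul_right (c := finrank F U) ?_ (by omega)
    rw [h3, mul_comm (finrank F K)]
    exact Nat.mul_le_mul_right _ h1

omit [Finite F] in
theorem IsProperlyMaximumHScattered.finrank_inf_ker (hU : IsProperlyMaximumHScattered h S U)
    {φ : Dual K V} (hφ : ¬ S ≤ LinearMap.ker φ) :
    ∃ i ≤ h, finrank F (U ⊓ (LinearMap.ker φ).restrictScalars F : Submodule F V) =
        finrank F U - finrank F K + i ∧
      finrank F (LinearMap.range (pullDual (inclusionMap hU.1.le) (φ.domRestrict S))) + i =
        finrank F K := by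
  have : Module.Finite F V := Module.Finite.of_finite
  have : Module.Finite K V := Module.Finite.of_finite
  have : Module.Finite F K := Module.Finite.of_finite
  have h0 : φ.domRestrict S ≠ 0 := by
    intro h0
    exact hφ fun v hv => LinearMap.congr_fun h0 ⟨v, hv⟩
  obtain ⟨hb1, hb2, hb3⟩ := hU.bounds
  have h1 := finrank_le_finrank_range_pullDual hU.independencePreserving hb3 hU.2 h0
  have h2 := finrank_inf_ker_add_finrank_range hU.1.le φ
  have h3 : finrank F (LinearMap.range (pullDual (inclusionMap hU.1.le) (φ.domRestrict S))) ≤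
    finrank F K := Submodule.finrank_le _
  generalize finrank F (LinearMap.range (pullDual (inclusionMap hU.1.le) (φ.domRestrict S))) = x
    at *
  exact ⟨finrank F K - x, by omega, by omega, by omega⟩

omit [Finite K] in
theorem finrank_inf_ker_add_one {φ : Dual K V} (hφ : ¬ S ≤ LinearMap.ker φ) :
    finrank K (S ⊓ LinearMap.ker φ : Submodule K V) + 1 = finrank K S := by
  have : Module.Finite K V := Module.Finite.of_finite
  have h0 : φ.domRestrict S ≠ 0 := by
    intro h0
    exact hφ fun v hv => LinearMap.congr_fun h0 ⟨v, hv⟩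
  rw [← Module.Dual.finrank_ker_add_one_of_ne_zero h0, ← Submodule.map_comap_subtype,
    Submodule.finrank_map_subtype_eq]
  rfl

omit [Finite K] in
theorem isHyperplane_ker {φ : Dual K V} (hφ : φ ≠ 0) : IsHyperplane (LinearMap.ker φ) := by
  have : Module.Finite K V := Module.Finite.of_finite
  exact Module.Dual.finrank_ker_add_one_of_ne_zero hφ

omit [Finite K] in
theorem IsHyperplane.exists_ker_eq {H : Submodule K V} (hH : IsHyperplane H) :
    ∃ φ : Dual K V, φ ≠ 0 ∧ LinearMap.ker φ = H := by
  have : Module.Finite K V := Module.Finite.of_finite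
  have hlt : H < ⊤ := lt_top_iff_ne_top.2 fun h => by
    subst h
    simp [IsHyperplane] at hH
  obtain ⟨φ, hφ, hle⟩ := H.exists_le_ker_of_lt_top hlt
  refine ⟨φ, hφ, (Submodule.eq_of_le_of_finrank_eq hle ?_).symm⟩
  have h1 : finrank K H + 1 = finrank K V := hH
  have h2 := Module.Dual.finrank_ker_add_one_of_ne_zero hφ
  omega

omit [Finite K] [Finite V] in
theorem exists_dual_extension {S₁ S₂ : Submodule K V} (hdisj : Disjoint S₁ S₂) {y : V}
    (hy : y ∉ S₁ ⊔ S₂) (a : Dual K S₁) (t : K) :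
    ∃ φ : Dual K V, φ.domRestrict S₁ = a ∧ S₂ ≤ LinearMap.ker φ ∧ φ y = t := by
  obtain ⟨T, hT, hc⟩ := hdisj.symm.exists_isCompl
  obtain ⟨φ, hφ, hφy⟩ := LinearMap.exists_extend_of_notMem
    ((LinearMap.ofIsCompl hc.symm a 0).domRestrict (S₁ ⊔ S₂)) hy t
  refine ⟨φ, ?_, fun v hv => ?_, hφy⟩
  · ext v
    have := LinearMap.congr_fun hφ ⟨v, Submodule.mem_sup_left v.2⟩
    simpa using this
  · have h1 := LinearMap.congr_fun hφ ⟨v, Submodule.mem_sup_right hv⟩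
    have h2 := LinearMap.ofIsCompl_apply_right hc.symm (φ := a) (ψ := 0) ⟨v, hT hv⟩
    simp only [LinearMap.comp_apply, Submodule.subtype_apply, LinearMap.domRestrict_apply] at h1 h2
    rw [LinearMap.mem_ker, h1, h2, LinearMap.zero_apply]

end Weights

/-- The pairs (points at infinity, affine points) for the hyperplane at infinity, for the
hyperplanes that do not contain the vertex, and for the remaining hyperplanes. -/
def pairTypes (q n r d h : ℕ) : Set (ℤ × ℤ) :=
  {((q : ℤ) ^ (n * (r - d)) * (qBracket (q ^ n) d - qBracket q (d * n / (h + 1))), 0)} ∪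
  {m | d < r ∧ m = ((q : ℤ) ^ (n * (r - d - 1)) *
    (qBracket (q ^ n) d - qBracket q (d * n / (h + 1))),
    (q : ℤ) ^ (n * (r - d - 1)) * (q : ℤ) ^ (d * n / (h + 1)))} ∪
  {m | ∃ i ≤ h, ∃ j ≤ 1, m = ((q : ℤ) ^ (n * (r - d)) *
    (qBracket (q ^ n) (d - 1) - qBracket q (gammaRank d n h i)),
    (q : ℤ) ^ (n * (r - d)) * betaTerm q d n h i j)}

/-- A pair of natural numbers as a pair of integers. -/
def castPair (m : ℕ × ℕ) : ℤ × ℤ := (m.1, m.2)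

/-! ### The pairs of intersection sizes for all hyperplanes. -/

section Main

variable {F K V : Type*} [Field F] [Finite F] [Field K] [Finite K] [Algebra F K]
  [AddCommGroup V] [Module K V] [Module F V] [IsScalarTower F K V] [Finite V]
  {h : ℕ} {S₁ S₂ : Submodule K V} {U₁ : Submodule F V} {y : V}

/-- The numbers of points at infinity and of affine points of `X ∩ H`. -/
noncomputable def pairCounts (E : Submodule K V) (X : Set (ℙ K V)) (H : Submodule K V) : ℕ × ℕ :=
  ((X ∩ subspacePoints H ∩ subspacePoints E).ncard, ((X ∩ subspacePoints H) \ subspacePoints E).ncard)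

theorem natCard_eq_pow (F K : Type*) [Field F] [Field K] [Finite K] [Algebra F K] :
    Nat.card K = Nat.card F ^ finrank F K := by
  have : Module.Finite F K := Module.Finite.of_finite
  exact Module.natCard_eq_pow_finrank

omit [Finite F] [Finite K] [Finite V] in
theorem IsProperlyMaximumHScattered.rank_eq (hU : IsProperlyMaximumHScattered h S₁ U₁) :
    finrank K S₁ * finrank F K / (h + 1) = finrank F U₁ := by
  rw [← hU.2, Nat.mul_div_cancel_left _ (Nat.succ_pos h)]

theorem pairCounts_of_not_le_ker (hU : IsProperlyMaximumHScattered h S₁ U₁)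
    (hdisj : Disjoint S₁ S₂) (hy : y ∉ S₁ ⊔ S₂) {s : ℕ} (hs : finrank K S₂ = s + 1)
    {φ : Dual K V} (hφ : ¬ S₂ ≤ LinearMap.ker φ) :
    castPair (pairCounts (S₁ ⊔ S₂)
        (switchedSet (S₁ ⊔ S₂) (U₁ ⊔ S₂.restrictScalars F) y) (LinearMap.ker φ)) =
      ((Nat.card F : ℤ) ^ (finrank F K * s) * (qBracket (Nat.card F ^ finrank F K) (finrank K S₁) -
        qBracket (Nat.card F) (finrank F U₁)),
        (Nat.card F : ℤ) ^ (finrank F K * s) * (Nat.card F : ℤ) ^ (finrank F U₁)) := by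
  have : Module.Finite K V := Module.Finite.of_finite
  have hS₂ : Nat.card S₂ = Nat.card F ^ (finrank F K * s) * Nat.card K := by
    rw [Module.natCard_eq_pow_finrank (K := K), hs, pow_succ, natCard_eq_pow F K, pow_mul]
  have hK : 0 < Nat.card K := Nat.card_pos
  refine Prod.ext ?_ ?_
  · have h1 := ncard_at_infinity_of_not_le_ker (y := y) hU.1 hdisj hφ
    rw [hS₂] at h1
    push_cast at h1
    rw [mul_right_comm] at h1
    have h2 := mul_right_cancel₀ (by exact_mod_cast hK.ne') h1
    rw [← natCard_eq_pow F K]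
    exact h2
  · have h1 := ncard_affine_of_not_le_ker hU.1.le hdisj hy hφ
    rw [hS₂, ← mul_assoc] at h1
    have h2 := Nat.eq_of_mul_eq_mul_right hK h1
    rw [mul_comm] at h2
    simp only [pairCounts, castPair]
    rw [h2]
    push_cast
    rfl

omit [Finite F] [Module F V] [IsScalarTower F K V] in
theorem card_vertex : Nat.card S₂ = Nat.card F ^ (finrank F K * finrank K S₂) := by
  have : Module.Finite K V := Module.Finite.of_finite
  rw [Module.natCard_eq_pow_finrank (K := K), natCard_eq_pow F K, pow_mul]

theorem pairCounts_of_le_ker (hU : IsProperlyMaximumHScattered h S₁ U₁)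
    (hdisj : Disjoint S₁ S₂) (hy : y ∉ S₁ ⊔ S₂) {φ : Dual K V} (hφ : S₂ ≤ LinearMap.ker φ)
    {c : ℤ} (hc : (((U₁ : Set V) ∩ {v | φ v = -φ y}).ncard : ℤ) = c) :
    castPair (pairCounts (S₁ ⊔ S₂)
        (switchedSet (S₁ ⊔ S₂) (U₁ ⊔ S₂.restrictScalars F) y) (LinearMap.ker φ)) =
      ((Nat.card F : ℤ) ^ (finrank F K * finrank K S₂) * (qBracket (Nat.card F ^ finrank F K)
        (finrank K (S₁ ⊓ LinearMap.ker φ : Submodule K V)) - qBracket (Nat.card F)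
          (finrank F (U₁ ⊓ (LinearMap.ker φ).restrictScalars F : Submodule F V))),
        (Nat.card F : ℤ) ^ (finrank F K * finrank K S₂) * c) := by
  refine Prod.ext ?_ ?_
  · have h1 := ncard_at_infinity_of_le_ker (y := y) hU.1 hdisj hφ
    rw [card_vertex (F := F), natCard_eq_pow F K] at h1
    push_cast at h1
    exact h1
  · have h1 := ncard_affine_of_le_ker hU.1.le hdisj hy hφ
    rw [card_vertex (F := F)] at h1
    simp only [pairCounts, castPair]
    rw [h1, ← hc]
    push_cast
    rw [mul_comm]

theorem ncard_switchedSet (hU : IsProperlyMaximumHScattered h S₁ U₁)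
    (hdisj : Disjoint S₁ S₂) (hy : y ∉ S₁ ⊔ S₂) :
    ((switchedSet (S₁ ⊔ S₂) (U₁ ⊔ S₂.restrictScalars F) y).ncard : ℤ) =
      (Nat.card F : ℤ) ^ (finrank F K * finrank K S₂) *
        (qBracket (Nat.card F ^ finrank F K) (finrank K S₁) -
          qBracket (Nat.card F) (finrank F U₁) + (Nat.card F : ℤ) ^ finrank F U₁) := by
  have : Module.Finite F V := Module.Finite.of_finite
  -- The kernel of φ = 0 is the whole space, so the hyperplane formula also gives the size of the
  -- set.
  have h1 := pairCounts_of_le_ker hU hdisj hy (φ := 0) (c := (Nat.card F : ℤ) ^ finrank F U₁)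
    (by simp) (by
      simp only [LinearMap.zero_apply, neg_zero, Set.ofPred_true, Set.inter_univ]
      rw [← Nat.card_coe_set_eq, SetLike.coe_sort_coe, Module.natCard_eq_pow_finrank (K := F)]
      push_cast
      rfl)
  have h2 : subspacePoints (LinearMap.ker (0 : Dual K V)) = Set.univ := by
    ext p
    simp [subspacePoints]
  have h3 : finrank K (S₁ ⊓ LinearMap.ker (0 : Dual K V) : Submodule K V) = finrank K S₁ := by
    rw [LinearMap.ker_zero, inf_top_eq]
  have h4 : finrank F (U₁ ⊓ (LinearMap.ker (0 : Dual K V)).restrictScalars F : Submodule F V) =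
      finrank F U₁ := by
    rw [LinearMap.ker_zero, Submodule.restrictScalars_top, inf_top_eq]
  rw [h3, h4, pairCounts, h2, Set.inter_univ] at h1
  have h5 := congrArg Prod.fst h1
  have h6 := congrArg Prod.snd h1
  simp only [castPair] at h5 h6
  rw [← Set.ncard_inter_add_ncard_sdiff_eq_ncard
    (switchedSet (S₁ ⊔ S₂) (U₁ ⊔ S₂.restrictScalars F) y) (subspacePoints (S₁ ⊔ S₂))]
  push_cast
  rw [h5, h6]
  ring

-- The exceptional case j = 0, i ≥ 1 of β encodes an empty fibre; otherwise the fibre is a coset of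
-- U₁ ∩ ker φ.
omit [Finite K] in
theorem betaTerm_eq_ncard (φ : Dual K V) {i : ℕ}
    (hi : finrank F (U₁ ⊓ (LinearMap.ker φ).restrictScalars F : Submodule F V) =
      gammaRank (finrank K S₁) (finrank F K) h i) {j : ℕ}
    (hj : (j = 0 ∧ 1 ≤ i) ↔ ¬ ∃ u ∈ U₁, φ u = -φ y) :
    (((U₁ : Set V) ∩ {v | φ v = -φ y}).ncard : ℤ) =
      betaTerm (Nat.card F) (finrank K S₁) (finrank F K) h i j := by
  have h1 := ncard_inter_fiber U₁ φ (-φ y)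
  unfold betaTerm
  split_ifs with hc
  · rw [h1.2 (hj.1 hc)]
    rfl
  · rw [h1.1 (by rwa [hj, not_not] at hc), hi]
    push_cast
    rfl

omit [Finite F] [Finite K] [Finite V] in
theorem exists_mem_apply_eq_iff (hU : IsProperlyMaximumHScattered h S₁ U₁) (φ : Dual K V)
    (c : K) : (∃ u ∈ U₁, φ u = c) ↔
      c ∈ LinearMap.range (pullDual (inclusionMap hU.1.le) (φ.domRestrict S₁)) := by
  constructor
  · rintro ⟨u, hu, h⟩
    exact ⟨⟨u, hu⟩, h⟩
  · rintro ⟨u, h⟩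
    exact ⟨u, u.2, h⟩

theorem pairCounts_of_sup_le_ker (hU : IsProperlyMaximumHScattered h S₁ U₁)
    (hdisj : Disjoint S₁ S₂) (hy : y ∉ S₁ ⊔ S₂) {φ : Dual K V} (hφ₁ : S₁ ≤ LinearMap.ker φ)
    (hφ₂ : S₂ ≤ LinearMap.ker φ) (hφy : φ y ≠ 0) :
    castPair (pairCounts (S₁ ⊔ S₂)
        (switchedSet (S₁ ⊔ S₂) (U₁ ⊔ S₂.restrictScalars F) y) (LinearMap.ker φ)) =
      ((Nat.card F : ℤ) ^ (finrank F K * finrank K S₂) * (qBracket (Nat.card F ^ finrank F K)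
        (finrank K S₁) - qBracket (Nat.card F) (finrank F U₁)), 0) := by
  have h1 := pairCounts_of_le_ker (c := 0) hU hdisj hy hφ₂ (by
    rw [(ncard_inter_fiber U₁ φ (-φ y)).2]
    · rfl
    · rintro ⟨u, hu, h⟩
      rw [show φ u = 0 from hφ₁ (hU.1.le hu), eq_comm, neg_eq_zero] at h
      exact hφy h)
  have h2 : U₁ ⊓ (LinearMap.ker φ).restrictScalars F = U₁ :=
    inf_eq_left.2 fun u hu => hφ₁ (hU.1.le hu)
  rwa [inf_eq_left.2 hφ₁, h2, mul_zero] at h1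

theorem pairCounts_of_vertex_le_ker (hU : IsProperlyMaximumHScattered h S₁ U₁)
    (hdisj : Disjoint S₁ S₂) (hy : y ∉ S₁ ⊔ S₂) {φ : Dual K V} (hφ₁ : ¬ S₁ ≤ LinearMap.ker φ)
    (hφ₂ : S₂ ≤ LinearMap.ker φ) {i : ℕ}
    (hi : finrank F (U₁ ⊓ (LinearMap.ker φ).restrictScalars F : Submodule F V) =
      gammaRank (finrank K S₁) (finrank F K) h i) {j : ℕ}
    (hj : (j = 0 ∧ 1 ≤ i) ↔ ¬ ∃ u ∈ U₁, φ u = -φ y) :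
    castPair (pairCounts (S₁ ⊔ S₂)
        (switchedSet (S₁ ⊔ S₂) (U₁ ⊔ S₂.restrictScalars F) y) (LinearMap.ker φ)) =
      ((Nat.card F : ℤ) ^ (finrank F K * finrank K S₂) * (qBracket (Nat.card F ^ finrank F K)
        (finrank K S₁ - 1) - qBracket (Nat.card F) (gammaRank (finrank K S₁) (finrank F K) h i)),
        (Nat.card F : ℤ) ^ (finrank F K * finrank K S₂) *
          betaTerm (Nat.card F) (finrank K S₁) (finrank F K) h i j) := by
  have h1 := pairCounts_of_le_ker hU hdisj hy hφ₂ (betaTerm_eq_ncard φ hi hj)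
  rwa [hi, show finrank K (S₁ ⊓ LinearMap.ker φ : Submodule K V) = finrank K S₁ - 1 by
    have := finrank_inf_ker_add_one hφ₁
    omega] at h1

theorem image_intersectionPairs (hU : IsProperlyMaximumHScattered h S₁ U₁)
    (hdisj : Disjoint S₁ S₂) (hy : y ∉ S₁ ⊔ S₂)
    (hE : finrank K (S₁ ⊔ S₂ : Submodule K V) + 1 = finrank K V) :
    castPair '' intersectionPairs (S₁ ⊔ S₂)
        (switchedSet (S₁ ⊔ S₂) (U₁ ⊔ S₂.restrictScalars F) y) =
      pairTypes (Nat.card F) (finrank F K) (finrank K S₁ + finrank K S₂) (finrank K S₁) h := by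
  have : Module.Finite K V := Module.Finite.of_finite
  have : Module.Finite F V := Module.Finite.of_finite
  have : Module.Finite F K := Module.Finite.of_finite
  obtain ⟨hb1, hb2, hb3⟩ := hU.bounds
  have hspan : (S₁ ⊔ S₂) ⊔ Submodule.span K {y} = ⊤ :=
    Submodule.eq_top_of_finrank_eq (by rw [Submodule.finrank_sup_span_singleton hy, hE])
  have hrank := hU.rank_eq
  have hgamma : ∀ i, gammaRank (finrank K S₁) (finrank F K) h i =
      finrank F U₁ - finrank F K + i := fun i => by rw [gammaRank, hrank]
  unfold pairTypes
  rw [hrank, Nat.add_sub_cancel_left]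
  apply Set.Subset.antisymm
  · rintro _ ⟨_, ⟨H, hH, rfl⟩, rfl⟩
    obtain ⟨φ, hφ0, rfl⟩ := hH.exists_ker_eq
    by_cases hφ : S₂ ≤ LinearMap.ker φ
    · by_cases hφ1 : S₁ ≤ LinearMap.ker φ
      · refine Or.inl (Or.inl ?_)
        have hφy : φ y ≠ 0 := fun h0 => by
          refine hφ0 (LinearMap.ker_eq_top.1 (top_le_iff.1 ?_))
          rw [← hspan]
          refine sup_le (sup_le hφ1 hφ) ?_
          rwa [Submodule.span_singleton_le_iff_mem]
        exact pairCounts_of_sup_le_ker hU hdisj hy hφ1 hφ hφy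
      · refine Or.inr ?_
        obtain ⟨i, hih, hi, hrange⟩ := hU.finrank_inf_ker hφ1
        rw [← hgamma] at hi
        have hj : ∃ j ≤ 1, ((j = 0 ∧ 1 ≤ i) ↔ ¬ ∃ u ∈ U₁, φ u = -φ y) := by
          by_cases hex : ∃ u ∈ U₁, φ u = -φ y
          · exact ⟨1, le_rfl, by simpa using hex⟩
          -- For i = 0 the image of `U₁` under φ is all of K, so the fibre cannot be empty.
          · refine ⟨0, zero_le_one, iff_of_true ⟨rfl, Nat.one_le_iff_ne_zero.2 fun h0 => hex ?_⟩ hex⟩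
            have htop : LinearMap.range (pullDual (inclusionMap hU.1.le) (φ.domRestrict S₁)) = ⊤ :=
              Submodule.eq_top_of_finrank_eq (by simpa [h0] using hrange)
            rw [exists_mem_apply_eq_iff hU, htop]
            trivial
        obtain ⟨j, hj1, hj⟩ := hj
        exact ⟨i, hih, j, hj1, pairCounts_of_vertex_le_ker hU hdisj hy hφ1 hφ hi hj⟩
    · refine Or.inl (Or.inr ?_)
      have hpos : finrank K S₂ ≠ 0 := fun h0 => hφ (by
        rw [Submodule.finrank_eq_zero.1 h0]
        exact bot_le)
      exact ⟨by omega, pairCounts_of_not_le_ker hU hdisj hy (by omega) hφ⟩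
  · rintro m ((hm | ⟨hd, rfl⟩) | ⟨i, hi, j, hj, rfl⟩)
    · obtain ⟨φ, hφ₁, hφ₂, hφy⟩ := exists_dual_extension hdisj hy 0 1
      have hφ₁' : S₁ ≤ LinearMap.ker φ := fun v hv => LinearMap.congr_fun hφ₁ ⟨v, hv⟩
      have hφy' : φ y ≠ 0 := by simp [hφy]
      rw [Set.mem_singleton_iff.1 hm]
      exact ⟨_, ⟨_, isHyperplane_ker (fun h0 => hφy' (by rw [h0]; rfl)), rfl⟩,
        pairCounts_of_sup_le_ker hU hdisj hy hφ₁' hφ₂ hφy'⟩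
    · have hne : S₂ ≠ ⊥ := by
        rintro rfl
        simp at hd
      obtain ⟨s, hs, hs0⟩ := S₂.exists_mem_ne_zero_of_ne_bot hne
      obtain ⟨φ, hφ, -⟩ := Submodule.exists_le_ker_of_notMem (K := K) (p := ⊥) (v := s)
        (by simpa using hs0)
      exact ⟨_, ⟨_, isHyperplane_ker (fun h0 => hφ (by rw [h0]; rfl)), rfl⟩,
        pairCounts_of_not_le_ker hU hdisj hy (by omega) fun hle => hφ (hle hs)⟩
    · obtain ⟨a, ha⟩ := exists_finrank_range_pullDual_eq hU.independencePreserving hb3 hU.2 hi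
        hb2 hb1
      -- Here t will be φ(y). For i ≥ 1 the image is proper, so -t can be chosen outside it; t = 0
      -- always meets it.
      have ht : ∃ t : K, (j = 0 ∧ 1 ≤ i) ↔
          ¬ -t ∈ LinearMap.range (pullDual (inclusionMap hU.1.le) a) := by
        by_cases hji : j = 0 ∧ 1 ≤ i
        · have hne : LinearMap.range (pullDual (inclusionMap hU.1.le) a) ≠ ⊤ := fun htop => by
            rw [htop, finrank_top] at ha
            omega
          obtain ⟨x, -, hx⟩ := SetLike.exists_of_lt hne.lt_top
          exact ⟨-x, by simpa [hji] using hx⟩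
        · exact ⟨0, by simpa using hji⟩
      obtain ⟨t, ht⟩ := ht
      obtain ⟨φ, hφ₁, hφ₂, hφy⟩ := exists_dual_extension hdisj hy a t
      have hrange := finrank_inf_ker_add_finrank_range hU.1.le φ
      rw [hφ₁] at hrange
      have hφ₁' : ¬ S₁ ≤ LinearMap.ker φ := fun hle => by
        have h0 : a = 0 := by
          rw [← hφ₁]
          ext v
          exact hle v.2
        rw [h0, map_zero, LinearMap.range_zero, finrank_bot] at ha
        omega
      have hφ0 : φ ≠ 0 := by
        rintro rfl
        simp at hφ₁'
      refine ⟨_, ⟨_, isHyperplane_ker hφ0, rfl⟩,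
        pairCounts_of_vertex_le_ker hU hdisj hy hφ₁' hφ₂ ?_ ?_⟩
      · rw [hgamma]
        omega
      · rw [exists_mem_apply_eq_iff hU, hφ₁, hφy]
        exact ht

omit [Finite K] in
theorem intersectionNumbers_eq_image (E : Submodule K V) (X : Set (ℙ K V)) :
    intersectionNumbers X = (fun m : ℕ × ℕ => m.1 + m.2) '' intersectionPairs E X := by
  have hsum : ∀ H : Submodule K V, (X ∩ subspacePoints H).ncard =
      (X ∩ subspacePoints H ∩ subspacePoints E).ncard +
        ((X ∩ subspacePoints H) \ subspacePoints E).ncard := fun H =>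
    (Set.ncard_inter_add_ncard_sdiff_eq_ncard _ _).symm
  ext m
  constructor
  · rintro ⟨H, hH, rfl⟩
    exact ⟨_, ⟨H, hH, rfl⟩, (hsum H).symm⟩
  · rintro ⟨_, ⟨H, hH, rfl⟩, rfl⟩
    exact ⟨H, hH, (hsum H).symm⟩

end Main

/-! ### Coincidences among the values for q = 2. -/

section Arithmetic

theorem qBracket_two (k : ℕ) : qBracket 2 k = 2 ^ k - 1 := by
  have := mul_geom_sum (2 : ℤ) k
  simp only [qBracket, Nat.cast_ofNat]
  linarith

theorem qBracket_succ (q k : ℕ) : qBracket q (k + 1) = qBracket q k + (q : ℤ) ^ k := by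
  simp [qBracket, Finset.sum_range_succ]

theorem qBracket_succ' (q k : ℕ) : qBracket q (k + 1) = q * qBracket q k + 1 := by
  simp [qBracket, Finset.sum_range_succ', Finset.mul_sum, pow_succ']

theorem injective_castPair : Function.Injective castPair := fun x y hxy => by
  simpa [castPair, Prod.ext_iff] using hxy

variable {n r d h k : ℕ}

/-- As h+1 ≥ 2 and d ≥ 2, k ≤ dn/2 ≤ (d-1)n, with equality only for d = 2. -/
theorem le_mul_sub_one (hh : 1 ≤ h) (hd : h + 1 ≤ d) (hk : (h + 1) * k = d * n) :
    k ≤ n * (d - 1) := by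
  obtain ⟨d, rfl⟩ : ∃ e, d = e + 2 := ⟨d - 2, by omega⟩
  simp only [show d + 2 - 1 = d + 1 by omega]
  nlinarith [Nat.mul_le_mul_right k (show 2 ≤ h + 1 by omega), Nat.zero_le (d * n)]

theorem eq_mul_sub_one_iff (hh : 1 ≤ h) (hd : h + 1 ≤ d) (hn : 2 ≤ n)
    (hk : (h + 1) * k = d * n) : k = n * (d - 1) ↔ d = 2 := by
  constructor
  · rintro rfl
    obtain ⟨d, rfl⟩ : ∃ e, d = e + 2 := ⟨d - 2, by omega⟩
    simp only [show d + 2 - 1 = d + 1 by omega] at hk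
    nlinarith [Nat.mul_le_mul_right (n * (d + 1)) (show 2 ≤ h + 1 by omega)]
  · rintro rfl
    obtain rfl : h = 1 := by omega
    simp only [Nat.add_one_sub_one]
    omega

theorem image_third_pairs (q n r d h : ℕ) :
    {m : ℤ × ℤ | ∃ i ≤ h, ∃ j ≤ 1, m = ((q : ℤ) ^ (n * (r - d)) *
      (qBracket (q ^ n) (d - 1) - qBracket q (gammaRank d n h i)),
      (q : ℤ) ^ (n * (r - d)) * betaTerm q d n h i j)} =
    (fun i => ((q : ℤ) ^ (n * (r - d)) *
      (qBracket (q ^ n) (d - 1) - qBracket q (gammaRank d n h i)),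
      (q : ℤ) ^ (n * (r - d)) * (q : ℤ) ^ gammaRank d n h i)) '' Set.Icc 0 h ∪
    (fun i => ((q : ℤ) ^ (n * (r - d)) *
      (qBracket (q ^ n) (d - 1) - qBracket q (gammaRank d n h i)), (0 : ℤ))) '' Set.Icc 1 h := by
  ext m
  constructor
  · rintro ⟨i, hi, j, hj, rfl⟩
    by_cases hc : j = 0 ∧ 1 ≤ i
    · exact Or.inr ⟨i, ⟨hc.2, hi⟩, by simp [betaTerm, hc]⟩
    · exact Or.inl ⟨i, ⟨Nat.zero_le i, hi⟩, by simp only [betaTerm, if_neg hc]⟩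
  · rintro (⟨i, hi, rfl⟩ | ⟨i, hi, rfl⟩)
    · exact ⟨i, hi.2, 1, le_rfl, by simp [betaTerm]⟩
    · exact ⟨i, hi.2, 0, zero_le_one, by simp [betaTerm, hi.1]⟩

theorem ncard_setOf_and_eq {α : Type*} (p : Prop) [Decidable p] (b : α) :
    {m | p ∧ m = b}.ncard = if p then 1 else 0 := by
  split_ifs with hp <;> simp [hp]

theorem ncard_natIcc (a b : ℕ) : (Set.Icc a b).ncard = b + 1 - a := by
  rw [← Finset.coe_Icc, Set.ncard_coe_finset, Nat.card_Icc]

theorem ncard_pairTypes_two (hh : 1 ≤ h) (hd : h + 1 ≤ d) (hn : 2 ≤ n)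
    (hk : (h + 1) * k = d * n) (hnk : n ≤ k) :
    (pairTypes 2 n r d h).ncard = if d < r then 2 * h + 3 else 2 * h + 2 := by
  have hdiv : d * n / (h + 1) = k := by rw [← hk, Nat.mul_div_cancel_left _ (Nat.succ_pos h)]
  obtain ⟨e, rfl⟩ : ∃ e, d = e + 1 := ⟨d - 1, by omega⟩
  obtain ⟨g, rfl⟩ : ∃ g, k = n + g := ⟨k - n, by omega⟩
  have hgamma : ∀ i, gammaRank (e + 1) n h i = g + i := fun i => by
    rw [gammaRank, hdiv, Nat.add_sub_cancel_left]
  have hle : (2 : ℤ) ^ (n + g) ≤ 2 ^ (n * e) :=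
    pow_le_pow_right₀ (by norm_num) (le_mul_sub_one hh hd hk)
  have h4 : (4 : ℤ) ≤ 2 ^ n := by
    calc (4 : ℤ) = 2 ^ 2 := by norm_num
      _ ≤ 2 ^ n := pow_le_pow_right₀ (by norm_num) hn
  have hD := qBracket_succ (2 ^ n) e
  have hD' := qBracket_succ' (2 ^ n) e
  push_cast at hD hD'
  rw [← pow_mul] at hD
  have hpos : ∀ m : ℕ, (0 : ℤ) < 2 ^ m := fun m => by positivity
  unfold pairTypes
  rw [image_third_pairs]
  simp only [hdiv, hgamma, qBracket_two, Nat.cast_ofNat, Nat.add_sub_cancel]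
  generalize qBracket (2 ^ n) (e + 1) = D at *
  generalize qBracket (2 ^ n) e = D' at *
  have hfin : ∀ (f : ℕ → ℤ × ℤ) (a b : ℕ), (f '' Set.Icc a b).Finite :=
    fun f a b => (Set.finite_Icc a b).image f
  have hinj : ∀ x : ℕ → ℤ, Function.Injective fun i => ((2 : ℤ) ^ (n * (r - (e + 1))) *
      (D' - (2 ^ (g + i) - 1)), x i) := by
    intro x i j hij
    have h1 := mul_left_cancel₀ (hpos _).ne' (congrArg Prod.fst hij)
    have h2 : (2 : ℤ) ^ (g + i) = 2 ^ (g + j) := by linarith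
    have h3 := pow_right_injective₀ (by norm_num : (0 : ℤ) < 2) (by norm_num) h2
    omega
  have hfinb : {m : ℤ × ℤ | e + 1 < r ∧ m = (2 ^ (n * (r - (e + 1) - 1)) *
      (D - (2 ^ (n + g) - 1)), 2 ^ (n * (r - (e + 1) - 1)) * 2 ^ (n + g))}.Finite :=
    (Set.finite_singleton _).subset fun m hm => hm.2
  rw [Set.ncard_union_eq _ ((Set.finite_singleton _).union hfinb) ((hfin _ _ _).union (hfin _ _ _)),
    Set.ncard_union_eq _ (Set.finite_singleton _) hfinb,
    Set.ncard_union_eq _ (hfin _ _ _) (hfin _ _ _), Set.ncard_image_of_injective _ (hinj _),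
    Set.ncard_image_of_injective _ (hinj _), ncard_setOf_and_eq, Set.ncard_singleton,
    ncard_natIcc, ncard_natIcc]
  · split_ifs <;> omega
  · rw [Set.disjoint_left]
    rintro _ ⟨i, -, rfl⟩ ⟨j, -, hj⟩
    have h1 := congrArg Prod.snd hj
    have h2 := mul_pos (hpos (n * (r - (e + 1)))) (hpos (g + i))
    exact h2.ne h1
  · rw [Set.disjoint_left]
    rintro _ rfl ⟨-, hm⟩
    have h1 := congrArg Prod.snd hm
    have h2 := mul_pos (hpos (n * (r - (e + 1) - 1))) (hpos (n + g))
    exact h2.ne h1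
  · rw [Set.disjoint_left]
    rintro _ (rfl | ⟨hr, rfl⟩) (⟨i, -, hi⟩ | ⟨i, -, hi⟩)
    · have h1 := congrArg Prod.snd hi
      have h2 := mul_pos (hpos (n * (r - (e + 1)))) (hpos (g + i))
      exact h2.ne' h1
    · have h1 := mul_left_cancel₀ (hpos _).ne' (congrArg Prod.fst hi)
      have := hpos (g + i)
      linarith
    · obtain ⟨s, rfl⟩ : ∃ s, r = e + 1 + s + 1 := ⟨r - (e + 1) - 1, by omega⟩
      have h0 : (2 : ℤ) ^ (n * (e + 1 + s + 1 - (e + 1))) =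
          2 ^ (n * (e + 1 + s + 1 - (e + 1) - 1)) * 2 ^ n := by
        rw [← pow_add]
        congr 1
        rw [show e + 1 + s + 1 - (e + 1) = s + 1 by omega, Nat.add_sub_cancel]
        ring
      simp only [h0, mul_assoc] at hi
      have h1 := mul_left_cancel₀ (hpos _).ne' (congrArg Prod.fst hi)
      have h2 := mul_left_cancel₀ (hpos _).ne' (congrArg Prod.snd hi)
      -- Equal affine counts make the powers of 2 cancel, leaving 2^n = 2 against n ≥ 2.
      rw [← h2] at h1
      linarith
    · have h1 := congrArg Prod.snd hi
      have h2 := mul_pos (hpos (n * (r - (e + 1) - 1))) (hpos (n + g))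
      exact h2.ne h1

/-- All nonempty fibres give the same total, since β cancels 2^γ_i; only the h empty-fibre cases
still depend on i. -/
theorem image_third_numbers (n r d h : ℕ) :
    {m : ℤ | ∃ i ≤ h, ∃ j ≤ 1, m = 2 ^ (n * (r - d)) *
      (qBracket (2 ^ n) (d - 1) - 2 ^ gammaRank d n h i + 1 + betaTerm 2 d n h i j)} =
    insert ((2 : ℤ) ^ (n * (r - d)) * (qBracket (2 ^ n) (d - 1) + 1))
      ((fun i => (2 : ℤ) ^ (n * (r - d)) *
        (qBracket (2 ^ n) (d - 1) - 2 ^ gammaRank d n h i + 1)) '' Set.Icc 1 h) := by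
  ext m
  constructor
  · rintro ⟨i, hi, j, hj, rfl⟩
    by_cases hc : j = 0 ∧ 1 ≤ i
    · exact Or.inr ⟨i, ⟨hc.2, hi⟩, by simp [betaTerm, hc]⟩
    · refine Or.inl ?_
      simp only [betaTerm, if_neg hc, Nat.cast_ofNat]
      ring
  · rintro (rfl | ⟨i, hi, rfl⟩)
    · refine ⟨0, Nat.zero_le h, 1, le_rfl, ?_⟩
      simp only [betaTerm, one_ne_zero, false_and, if_false, Nat.cast_ofNat]
      ring
    · exact ⟨i, hi.2, 0, zero_le_one, by simp [betaTerm, hi.1]⟩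

theorem ncard_numbers_two (hh : 1 ≤ h) (hd : h + 1 ≤ d) (hn : 2 ≤ n)
    (hk : (h + 1) * k = d * n) (hnk : n ≤ k) :
    ({(2 : ℤ) ^ (n * (r - d)) * (qBracket (2 ^ n) d - 2 ^ (d * n / (h + 1)) + 1)} ∪
        {m : ℤ | d < r ∧ m = 2 ^ (n * (r - d - 1)) * (qBracket (2 ^ n) d + 1)} ∪
        {m : ℤ | ∃ i ≤ h, ∃ j ≤ 1, m = 2 ^ (n * (r - d)) *
          (qBracket (2 ^ n) (d - 1) - 2 ^ gammaRank d n h i + 1 +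
            betaTerm 2 d n h i j)}).ncard + (if d = 2 then 1 else 0) =
      if d < r then h + 3 else h + 2 := by
  have hdiv : d * n / (h + 1) = k := by rw [← hk, Nat.mul_div_cancel_left _ (Nat.succ_pos h)]
  have heq := eq_mul_sub_one_iff hh hd hn hk
  rw [image_third_numbers]
  obtain ⟨e, rfl⟩ : ∃ e, d = e + 1 := ⟨d - 1, by omega⟩
  obtain ⟨g, rfl⟩ : ∃ g, k = n + g := ⟨k - n, by omega⟩
  have hgamma : ∀ i, gammaRank (e + 1) n h i = g + i := fun i => by
    rw [gammaRank, hdiv, Nat.add_sub_cancel_left]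
  have hle : (2 : ℤ) ^ (n + g) ≤ 2 ^ (n * e) :=
    pow_le_pow_right₀ (by norm_num) (le_mul_sub_one hh hd hk)
  have h4 : (4 : ℤ) ≤ 2 ^ n := by
    calc (4 : ℤ) = 2 ^ 2 := by norm_num
      _ ≤ 2 ^ n := pow_le_pow_right₀ (by norm_num) hn
  have h4' : (4 : ℤ) ∣ 2 ^ n := by
    rw [show (4 : ℤ) = 2 ^ 2 by norm_num]
    exact pow_dvd_pow 2 hn
  have hD := qBracket_succ (2 ^ n) e
  have hD' := qBracket_succ' (2 ^ n) e
  push_cast at hD hD'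
  rw [← pow_mul] at hD
  have hpos : ∀ m : ℕ, (0 : ℤ) < 2 ^ m := fun m => by positivity
  simp only [hdiv, hgamma, Nat.add_sub_cancel] at heq ⊢
  generalize qBracket (2 ^ n) (e + 1) = D at *
  generalize qBracket (2 ^ n) e = D' at *
  have hinj : Function.Injective fun i : ℕ => (2 : ℤ) ^ (n * (r - (e + 1))) *
      (D' - 2 ^ (g + i) + 1) := by
    intro i j hij
    have h1 := mul_left_cancel₀ (hpos _).ne' hij
    have h2 : (2 : ℤ) ^ (g + i) = 2 ^ (g + j) := by linarith
    have h3 := pow_right_injective₀ (by norm_num : (0 : ℤ) < 2) (by norm_num) h2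
    omega
  have hCfin : ((fun i : ℕ => (2 : ℤ) ^ (n * (r - (e + 1))) * (D' - 2 ^ (g + i) + 1)) ''
      Set.Icc 1 h).Finite := (Set.finite_Icc 1 h).image _
  have hC : (insert ((2 : ℤ) ^ (n * (r - (e + 1))) * (D' + 1))
      ((fun i : ℕ => (2 : ℤ) ^ (n * (r - (e + 1))) * (D' - 2 ^ (g + i) + 1)) ''
        Set.Icc 1 h)).ncard = h + 1 := by
    rw [Set.ncard_insert_of_notMem _ hCfin, Set.ncard_image_of_injective _ hinj, ncard_natIcc]
    · omega
    · rintro ⟨i, -, hi⟩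
      have h1 := mul_left_cancel₀ (hpos _).ne' hi
      have := hpos (g + i)
      linarith
  have hfinb : {m : ℤ | e + 1 < r ∧ m = 2 ^ (n * (r - (e + 1) - 1)) * (D + 1)}.Finite :=
    (Set.finite_singleton _).subset fun m hm => hm.2
  have ha : e + 1 < r → (2 : ℤ) ^ (n * (r - (e + 1))) =
      2 ^ (n * (r - (e + 1) - 1)) * 2 ^ n := by
    intro hr
    rw [← pow_add]
    congr 1
    obtain ⟨s, rfl⟩ : ∃ s, r = e + 1 + s + 1 := ⟨r - (e + 1) - 1, by omega⟩
    rw [show e + 1 + s + 1 - (e + 1) = s + 1 by omega, Nat.add_sub_cancel]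
    ring
  rw [Set.union_assoc, Set.singleton_union]
  have hBC : ({m : ℤ | e + 1 < r ∧ m = 2 ^ (n * (r - (e + 1) - 1)) * (D + 1)} ∪
      insert ((2 : ℤ) ^ (n * (r - (e + 1))) * (D' + 1))
      ((fun i : ℕ => (2 : ℤ) ^ (n * (r - (e + 1))) * (D' - 2 ^ (g + i) + 1)) ''
        Set.Icc 1 h)).ncard = (if e + 1 < r then 1 else 0) + (h + 1) := by
    rw [Set.ncard_union_eq _ hfinb (hCfin.insert _), hC, ncard_setOf_and_eq]
    rw [Set.disjoint_left]
    rintro _ ⟨hr, rfl⟩ (h1 | ⟨i, -, h1⟩)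
    · rw [ha hr, mul_assoc] at h1
      have h2 := mul_left_cancel₀ (hpos _).ne' h1
      linarith
    · simp only [ha hr, mul_assoc] at h1
      have h2 := mul_left_cancel₀ (hpos _).ne' h1
      have h3 : (2 : ℤ) ^ n * 2 ^ (g + i) ≥ 2 ^ n * 1 :=
        mul_le_mul_of_nonneg_left (by have := hpos (g + i); omega) (hpos n).le
      linarith
  -- The total at infinity can only agree with the nonempty-fibre total, and since D = D' +
  -- 2^(n(d-1)) this means k = n(d-1), that is, d = 2.
  have hmem : (2 : ℤ) ^ (n * (r - (e + 1))) * (D - 2 ^ (n + g) + 1) ∈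
      {m : ℤ | e + 1 < r ∧ m = 2 ^ (n * (r - (e + 1) - 1)) * (D + 1)} ∪
      insert ((2 : ℤ) ^ (n * (r - (e + 1))) * (D' + 1))
      ((fun i : ℕ => (2 : ℤ) ^ (n * (r - (e + 1))) * (D' - 2 ^ (g + i) + 1)) ''
        Set.Icc 1 h) ↔ e + 1 = 2 := by
    rw [← heq]
    constructor
    · rintro (⟨hr, h1⟩ | h1 | ⟨i, -, h1⟩)
      · rw [ha hr, mul_assoc] at h1
        have h2 := mul_left_cancel₀ (hpos _).ne' h1
        obtain ⟨c, hc⟩ := h4'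
        -- From D + 1 = 2^n D' + 2, agreement with the second total would make 2 divisible by 2^n,
        -- hence by 4.
        have h3 : 4 * (c * (D - 2 ^ (n + g) + 1 - D')) = 2 := by
          rw [hD', hc] at h2
          rw [hD', hc]
          linarith
        omega
      · have h2 := mul_left_cancel₀ (hpos _).ne' h1
        exact pow_right_injective₀ (by norm_num : (0 : ℤ) < 2) (by norm_num)
          (show (2 : ℤ) ^ (n + g) = 2 ^ (n * e) by linarith)
      · have h2 := mul_left_cancel₀ (hpos _).ne' h1
        have := hpos (g + i)
        linarith
    · intro h1
      refine Or.inr (Or.inl ?_)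
      rw [hD, h1]
      ring
  split_ifs with h2 hr hr
  · rw [Set.insert_eq_of_mem (hmem.2 h2), hBC, if_pos hr]
    omega
  · rw [Set.insert_eq_of_mem (hmem.2 h2), hBC, if_neg hr]
    omega
  · rw [Set.ncard_insert_of_notMem (fun hm => h2 (hmem.1 hm)) (hfinb.union (hCfin.insert _)), hBC,
      if_pos hr]
    omega
  · rw [Set.ncard_insert_of_notMem (fun hm => h2 (hmem.1 hm)) (hfinb.union (hCfin.insert _)), hBC,
      if_neg hr]
    omega

theorem image_pairTypes (q n r d h : ℕ) :
    (fun m : ℤ × ℤ => m.1 + m.2) '' pairTypes q n r d h =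
      {(q : ℤ) ^ (n * (r - d)) * (qBracket (q ^ n) d - qBracket q (d * n / (h + 1)))} ∪
      {m : ℤ | d < r ∧ m = (q : ℤ) ^ (n * (r - d - 1)) *
        (qBracket (q ^ n) d - qBracket q (d * n / (h + 1)) + (q : ℤ) ^ (d * n / (h + 1)))} ∪
      {m : ℤ | ∃ i ≤ h, ∃ j ≤ 1, m = (q : ℤ) ^ (n * (r - d)) *
        (qBracket (q ^ n) (d - 1) - qBracket q (gammaRank d n h i) + betaTerm q d n h i j)} := by
  unfold pairTypes
  rw [Set.image_union, Set.image_union, Set.image_singleton, add_zero]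
  congr 2
  · ext m
    constructor
    · rintro ⟨_, ⟨hr, rfl⟩, rfl⟩
      exact ⟨hr, (mul_add _ _ _).symm⟩
    · rintro ⟨hr, rfl⟩
      exact ⟨_, ⟨hr, rfl⟩, (mul_add _ _ _).symm⟩
  · ext m
    constructor
    · rintro ⟨_, ⟨i, hi, j, hj, rfl⟩, rfl⟩
      exact ⟨i, hi, j, hj, (mul_add _ _ _).symm⟩
    · rintro ⟨i, hi, j, hj, rfl⟩
      exact ⟨_, ⟨i, hi, j, hj, rfl⟩, (mul_add _ _ _).symm⟩

theorem numbers_two (n r d h : ℕ) :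
    ({((2 : ℕ) : ℤ) ^ (n * (r - d)) * (qBracket (2 ^ n) d - qBracket 2 (d * n / (h + 1)))} ∪
      {m : ℤ | d < r ∧ m = ((2 : ℕ) : ℤ) ^ (n * (r - d - 1)) *
        (qBracket (2 ^ n) d - qBracket 2 (d * n / (h + 1)) + ((2 : ℕ) : ℤ) ^ (d * n / (h + 1)))} ∪
      {m : ℤ | ∃ i ≤ h, ∃ j ≤ 1, m = ((2 : ℕ) : ℤ) ^ (n * (r - d)) *
        (qBracket (2 ^ n) (d - 1) - qBracket 2 (gammaRank d n h i) + betaTerm 2 d n h i j)}) =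
    {(2 : ℤ) ^ (n * (r - d)) * (qBracket (2 ^ n) d - 2 ^ (d * n / (h + 1)) + 1)} ∪
      {m : ℤ | d < r ∧ m = 2 ^ (n * (r - d - 1)) * (qBracket (2 ^ n) d + 1)} ∪
      {m : ℤ | ∃ i ≤ h, ∃ j ≤ 1, m = 2 ^ (n * (r - d)) *
        (qBracket (2 ^ n) (d - 1) - 2 ^ gammaRank d n h i + 1 + betaTerm 2 d n h i j)} := by
  have h1 : ∀ x y : ℤ, x - (y - 1) = x - y + 1 := fun x y => by ring
  have h2 : ∀ x y : ℤ, x - y + 1 + y = x + 1 := fun x y => by ring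
  simp only [qBracket_two, Nat.cast_ofNat, h1, h2]

end Arithmetic


/-! ### Assembly of the theorem. -/

theorem mainTheorem3 {F K V : Type*} [Field F] [Finite F] [Field K] [Finite K] [Algebra F K]
    [AddCommGroup V] [Module K V] [Module F V] [IsScalarTower F K V]
    (q n r d h : ℕ) (hq : Nat.card F = q) (hn : finrank F K = n)
    (hV : finrank K V = r + 1)
    -- the hyperplane at infinity `π_∞ = PG(E, K)`
    (E : Submodule K V) (hE : finrank K E = r)
    -- complementary subspaces `PG(S₁, K)`, `PG(S₂, K)` of `π_∞`
    (S₁ S₂ : Submodule K V) (hdisj : Disjoint S₁ S₂) (hsup : S₁ ⊔ S₂ = E)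
    (hd : finrank K S₁ = d)
    (U₁ : Submodule F V) (hU₁ : IsProperlyMaximumHScattered h S₁ U₁)
    (U : Submodule F V) (hU : U = U₁ ⊔ S₂.restrictScalars F)
    -- the affine point `Q = ⟨y⟩`
    (y : V) (hy : y ∉ E)
    (X : Set (ℙ K V)) (hX : X = switchedSet E U y) :
    -- `L_U` is the cone with vertex `PG(S₂, K)` and basis `L_{U₁}`
    linearSet K U = projectiveCone S₂ (linearSet K U₁) ∧
    -- the size of the set
    (X.ncard : ℤ) = (q : ℤ) ^ (n * (r - d)) *
      (qBracket (q ^ n) d - qBracket q (d * n / (h + 1)) + (q : ℤ) ^ (d * n / (h + 1))) ∧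
    -- its type with respect to the hyperplanes
    (fun m : ℕ => (m : ℤ)) '' intersectionNumbers X =
      {(q : ℤ) ^ (n * (r - d)) * (qBracket (q ^ n) d - qBracket q (d * n / (h + 1)))} ∪
      {m : ℤ | d < r ∧ m = (q : ℤ) ^ (n * (r - d - 1)) *
        (qBracket (q ^ n) d - qBracket q (d * n / (h + 1)) + (q : ℤ) ^ (d * n / (h + 1)))} ∪
      {m : ℤ | ∃ i ≤ h, ∃ j ≤ 1, m = (q : ℤ) ^ (n * (r - d)) *
        (qBracket (q ^ n) (d - 1) - qBracket q (gammaRank d n h i) + betaTerm q d n h i j)} ∧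
    -- the case `q = 2`
    (q = 2 →
      (X.ncard : ℤ) = 2 ^ (n * (r - d)) * (qBracket (2 ^ n) d + 1) ∧
      (fun m : ℕ => (m : ℤ)) '' intersectionNumbers X =
        {(2 : ℤ) ^ (n * (r - d)) * (qBracket (2 ^ n) d - 2 ^ (d * n / (h + 1)) + 1)} ∪
        {m : ℤ | d < r ∧ m = 2 ^ (n * (r - d - 1)) * (qBracket (2 ^ n) d + 1)} ∪
        {m : ℤ | ∃ i ≤ h, ∃ j ≤ 1, m = 2 ^ (n * (r - d)) *
          (qBracket (2 ^ n) (d - 1) - 2 ^ gammaRank d n h i + 1 + betaTerm 2 d n h i j)} ∧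
      -- the number of possibilities, counted by (points at infinity, affine points)
      (intersectionPairs E X).ncard = (if d < r then 2 * h + 3 else 2 * h + 2) ∧
      -- the number of distinct intersection numbers
      (intersectionNumbers X).ncard + (if d = 2 then 1 else 0) =
        (if d < r then h + 3 else h + 2)) := by
  subst hU hX hsup hq hn hd
  have hE' : finrank K (S₁ ⊔ S₂ : Submodule K V) + 1 = finrank K V := by rw [hE, hV]
  -- `finrank` is 0 in infinite dimension, so the value r + 1 already makes V finite-dimensional.
  have : Module.Finite K V := Module.finite_of_finrank_pos (by omega)
  have : Finite V := Module.finite_of_finite K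
  have hsum : finrank K S₁ + finrank K S₂ = r := by
    rw [← hE, ← Submodule.finrank_sup_add_finrank_inf_eq, hdisj.eq_bot, finrank_bot, add_zero]
  have hr : r - finrank K S₁ = finrank K S₂ := by omega
  obtain ⟨hb1, hb2, hb3⟩ := hU₁.bounds
  have hh := hU₁.1.1
  have hne : ∃ u ∈ U₁, u ≠ 0 := by
    refine U₁.exists_mem_ne_zero_of_ne_bot ?_
    rintro rfl
    simp at hb3
  have hcard := ncard_switchedSet hU₁ hdisj hy
  have hpairs := image_intersectionPairs hU₁ hdisj hy hE'
  rw [hsum] at hpairs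
  have hnumbers : (fun m : ℕ => (m : ℤ)) '' intersectionNumbers
      (switchedSet (S₁ ⊔ S₂) (U₁ ⊔ S₂.restrictScalars F) y) =
      (fun m : ℤ × ℤ => m.1 + m.2) '' pairTypes (Nat.card F) (finrank F K) r (finrank K S₁) h := by
    rw [← hpairs, intersectionNumbers_eq_image (S₁ ⊔ S₂), Set.image_image, Set.image_image]
    simp [castPair]
  rw [image_pairTypes] at hnumbers
  rw [← hU₁.rank_eq, ← hr] at hcard
  refine ⟨linearSet_eq_projectiveCone hne, hcard, hnumbers, fun hq => ?_⟩
  rw [hq] at hcard hnumbers hpairs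
  rw [numbers_two] at hnumbers
  refine ⟨?_, hnumbers, ?_, ?_⟩
  · rw [hcard, qBracket_two]
    push_cast
    ring
  · rw [← Set.ncard_image_of_injective _ injective_castPair, hpairs]
    exact ncard_pairTypes_two hh hU₁.1.2.1 (by omega) hU₁.2 hb1
  · rw [← Set.ncard_image_of_injective (intersectionNumbers _) (Nat.cast_injective (R := ℤ)),
      hnumbers]
    exact ncard_numbers_two hh hU₁.1.2.1 (by omega) hU₁.2 hb1
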